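/- Let $N\ge 1$, let $N=n_1+\dots+n_r$ with all $n_s\ge1$, and let $\lambda_1,\dots,\lambda_N\in\mathbb C$ be numbered so that the consecutive blocks $\{1,\dots,n_1\},\{n_1+1,\dots,n_1+n_2\},\dots$ of indices are exactly the congruence classes mod $\mathbb Z$ of the numbers $\lambda_j/N$ (that is, $(\lambda_i-\lambda_j)/N\in\mathbb Z$ if and only if $i,j$ lie in the same block), and so that $\Re(\lambda_j)$ is nonincreasing in $j$ within each block. For $B\subseteq\{1,\dots,N\}$ with $\#B=\ell\geq 1$ and $x\in\mathbb C\setminus\{0\}$, with a chosen value of $\ln x$ and $x^\omega=e^{\omega\ln x}$, Meijer's function $G^{\ell,0}_{0,N}$ with the parameters $\lambda_i/N$, $i\in B$, in front of the semicolon and $\lambda_i/N$, $i\notin B$, behind it is $$G_{0,N}^{\ell,0}\left(\left.\left\{\tfrac{\lambda_i}N\right\}_{i\in B};\left\{\tfrac{\lambda_i}N\right\}_{i\notin B}\,\right|\,x\right)=-\sum_{\omega_0}\operatorname{Res}_{\omega=\omega_0}\left(\frac{\prod_{i\in B}\Gamma(\frac{\lambda_i}N-\omega)}{\prod_{i\notin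 B}\Gamma(1-\frac{\lambda_i}N+\omega)}\,x^\omega\right),$$ where $\omega_0$ runs through the set of points $\frac{\lambda_i}N+n$, $i\in B$, $n=0,1,2,\dots$. For $1\le j\le N$ let $B_j$ be the set of indices from the beginning of the block of $j$ up to and including $j$, let $\ell_j=\#B_j$ be the position of $j$ in its block, and put $$\eta_j(\zeta)=G_{0,N}^{\ell_j,0}\left(\left.\left\{\tfrac{\lambda_i}N\right\}_{i\in B_j};\left\{\tfrac{\lambda_i}N\right\}_{i\notin B_j}\,\right|\,(-1)^{\ell_j}\zeta\right),\qquad \zeta\in\mathbb C\setminus\{0\}.$$ Then the following hold. (i) The sums of residues defining the $\eta_j$ converge absolutely for every $\zeta\in\mathbb C\setminus\{0\}$ and every value of the logarithm; and if $j$ is the first index of its block ($\ell_j=1$), then, with the same value of $\ln(-\zeta)$ on both sides, $$\eta_j(\zeta)=\frac{(-\zeta)^{\lambda_j/N}}{\prod_{i=1}^N\Gamma\left(1+\frac{\lambda_j-\lambda_i}N\right)}\;{}_0F_{N-1}\left(\left.\left\{1+\tfrac{\lambda_j-\lambda_i}N\right\}_{i\ne j}\,\right|\,\zeta\right),$$ where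 ${}_0F_{s}(\beta_1,\dots,\beta_s\,|\,\zeta)=\sum_{k\ge0}\frac{1}{(\beta_1)_k\cdots(\beta_s)_k}\frac{\zeta^k}{k!}$ and $(\beta)_k=\beta(\beta+1)\cdots(\beta+k-1)$. (ii) $\eta_1,\dots,\eta_N$ is a fundamental system of solutions of $$\Big[\prod_{j=1}^N\Big(\zeta\frac{d}{d\zeta}-\frac{\lambda_j}N\Big)-\zeta\Big]\eta(\zeta)=0,\qquad \zeta\in\mathbb C\setminus\{0\}.$$ (iii) For every $\mu\in\mathbb C\setminus\{0\}$, the functions $y_j(\mu,z)=\eta_j(\mu(z/N)^N)$, $1\le j\le N$, form a fundamental system of solutions of the generalized Euler eigenvalue equation $$z^{-N}\prod_{j=1}^N\Big[z\frac{d}{dz}-\lambda_j\Big]\,y(\mu,z)=\mu\,y(\mu,z),\qquad z\in\mathbb C\setminus\{0\}.$$ Since these functions are in general multivalued, (ii) and (iii) are understood as follows: on every nonempty connected open set $U\subseteq\mathbb C\setminus\{0\}$, and for every choice, for each $j$, of a holomorphic branch on $U$ of $\ln((-1)^{\ell_j}\zeta)$, respectively of $\ln((-1)^{\ell_j}\mu(z/N)^N)$,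 the resulting $N$ functions are holomorphic solutions on $U$, are linearly independent on $U$, and every holomorphic solution on $U$ is a linear combination of them. -/

import Mathlib

open Filter Topology

noncomputable section

namespace EulerMeijer

/-- The residue of `f` at an isolated singularity `a`: the value of
`(2πi)⁻¹ ∮ f` over all sufficiently small positively oriented circles around `a`. -/
def residue (f : ℂ → ℂ) (a : ℂ) : ℂ :=
  limUnder (𝓝[>] (0 : ℝ)) fun ρ : ℝ =>
    (2 * (Real.pi : ℂ) * Complex.I)⁻¹ * ∮ ω in C(a, ρ), f ω

/-- The integrand of the Mellin-type integral of `G_{p,q}^{m,n}`. The index sets `A` and `B` (with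
`n = #A`, `m = #B`) single out the parameters `a_k`, `b_j` written in front of the semicolons.
The variable `x ≠ 0` of the `G`-function enters through a logarithm `w` of `x`, so that
`x ^ ω = exp (ω * w)`. -/
def meijerIntegrand {p q : ℕ} (a : Fin p → ℂ) (A : Finset (Fin p)) (b : Fin q → ℂ)
    (B : Finset (Fin q)) (w ω : ℂ) : ℂ :=
  ((∏ j ∈ B, Complex.Gamma (b j - ω)) * ∏ k ∈ A, Complex.Gamma (1 - a k + ω)) /
    ((∏ j ∈ Bᶜ, Complex.Gamma (1 - b j + ω)) * ∏ k ∈ Aᶜ, Complex.Gamma (a k - ω)) *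
    Complex.exp (ω * w)

/-- The points `b_j + n`, `j ∈ B`, `n = 0, 1, 2, …`: the poles of the functions `Γ(b_j - ·)`. -/
def meijerPoles {q : ℕ} (b : Fin q → ℂ) (B : Finset (Fin q)) : Set ℂ :=
  {ω | ∃ j ∈ B, ∃ n : ℕ, ω = b j + n}

/-- Meijer's function `G_{p,q}^{m,n}` (`n = #A`, `m = #B`, `p < q`) at the point `x = exp w`, on the
branch given by `log x = w`: the sum of the residues of the integrand at the poles of the
`Γ(b_j - ·)`, `j ∈ B`, with a minus sign since the contour is negatively oriented. -/
def meijerG {p q : ℕ} (a : Fin p → ℂ) (A : Finset (Fin p)) (b : Fin q → ℂ)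
    (B : Finset (Fin q)) (w : ℂ) : ℂ :=
  -∑' ω : meijerPoles b B, residue (meijerIntegrand a A b B w) ω

/-- The generalized hypergeometric function `_rF_s`, with finite families of parameters `α`, `β`. -/
def genHypergeometric {ι κ : Type*} [Fintype ι] [Fintype κ] (α : ι → ℂ) (β : κ → ℂ) (ζ : ℂ) : ℂ :=
  ∑' k : ℕ, (∏ i, (ascPochhammer ℂ k).eval (α i)) / (∏ i, (ascPochhammer ℂ k).eval (β i)) *
    (ζ ^ k / (k.factorial : ℂ))

/-- The operator `∏_{j=1}^N (z d/dz - c_j)`. -/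
def eulerProd {N : ℕ} (c : Fin N → ℂ) (f : ℂ → ℂ) : ℂ → ℂ :=
  (List.ofFn c).foldr (fun c g z => z * deriv g z - c * g z) f

/-- The Euler differential expression `τ_N(λ_1, …, λ_N) = z^{-N} ∏_{j=1}^N (z d/dz - λ_j)`. -/
def eulerTau {N : ℕ} (lam : Fin N → ℂ) (y : ℂ → ℂ) (z : ℂ) : ℂ :=
  (z ^ N)⁻¹ * eulerProd lam y z

/-- `y` is a (holomorphic) solution on `U` of `τ_N(λ_1, …, λ_N) y = μ y`. -/
def IsEulerSolution {N : ℕ} (lam : Fin N → ℂ) (μ : ℂ) (U : Set ℂ) (y : ℂ → ℂ) : Prop :=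
  DifferentiableOn ℂ y U ∧ ∀ z ∈ U, eulerTau lam y z = μ * y z

/-- `η` is a (holomorphic) solution on `U` of `[∏_{j=1}^N (ζ d/dζ - b_j) - ζ] η = 0`. -/
def IsMeijerSolution {N : ℕ} (b : Fin N → ℂ) (U : Set ℂ) (η : ℂ → ℂ) : Prop :=
  DifferentiableOn ℂ η U ∧ ∀ ζ ∈ U, eulerProd b η ζ - ζ * η ζ = 0

/-- The functions `u j` form, on `U`, a fundamental system for the linear differential equation
whose solutions on `U` are described by `Sol`: they are solutions, they are linearly independent on
`U`, and every solution is on `U` a linear combination of them. -/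
def IsFundamentalSystem {N : ℕ} (U : Set ℂ) (Sol : (ℂ → ℂ) → Prop) (u : Fin N → ℂ → ℂ) : Prop :=
  (∀ j, Sol (u j)) ∧ LinearIndependent ℂ (fun j (z : U) => u j z) ∧
    ∀ f, Sol f → ∃ c : Fin N → ℂ, ∀ z ∈ U, f z = ∑ j, c j * u j z

/-- A domain in the punctured plane: a nonempty, open, connected subset of `ℂ \ {0}`. -/
def IsPuncturedDomain (U : Set ℂ) : Prop := IsOpen U ∧ IsConnected U ∧ (0 : ℂ) ∉ U

/-- `L` is a holomorphic branch on `U` of `log f`. -/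
def IsLogBranch (U : Set ℂ) (f L : ℂ → ℂ) : Prop :=
  DifferentiableOn ℂ L U ∧ ∀ z ∈ U, Complex.exp (L z) = f z

/-- The consecutive blocks `{1, …, n_1}, {n_1 + 1, …, n_1 + n_2}, …` of the composition
`N = n_1 + ⋯ + n_r` are the congruence classes mod `ℤ` of the `λ_j / N`, and within each block the
real parts of the `λ_j` are nonincreasing. -/
def IsCongruenceGrouping {N : ℕ} (lam : Fin N → ℂ) (c : Composition N) : Prop :=
  (∀ i j, c.index i = c.index j ↔ ∃ k : ℤ, (lam i - lam j) / N = k) ∧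
    ∀ i j, c.index i = c.index j → i ≤ j → (lam j).re ≤ (lam i).re

/-- The indices from the beginning of the block of `j` up to and including `j`. -/
def blockPrefix {N : ℕ} (c : Composition N) (j : Fin N) : Finset (Fin N) :=
  {i | c.index i = c.index j ∧ i ≤ j}

/-- The position `ℓ` of `j` in its block, counted from `1`. -/
def blockPos {N : ℕ} (c : Composition N) (j : Fin N) : ℕ := (blockPrefix c j).card

/-- With `ℓ = blockPos c j`: the function `G_{0,N}^{ℓ,0}` whose parameters in front of the semicolon
are the first `ℓ` of the `λ_i / N` in the block of `j`, and whose other parameters are all the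
remaining `λ_i / N`, evaluated at `exp w` on the branch given by `w`. -/
def blockG {N : ℕ} (lam : Fin N → ℂ) (c : Composition N) (j : Fin N) (w : ℂ) : ℂ :=
  meijerG (p := 0) ![] ∅ (fun i => lam i / N) (blockPrefix c j) w

end EulerMeijer

end

/-!
In the logarithmic variable `w = log x` everything is entire. The parameters in front of the
semicolon lie in one class mod `ℤ`, so the sum of residues is a sum of integrals over circles of
radius `1 / 2` around points `β + n`; the recursion for the Gamma function makes it converge faster
than any geometric series. The same recursion, applied under the integral sign, says that
`∏ (d/dw - b_j)` moves each circle by `-1` and produces the factor `(-1) ^ ℓ * exp w`, which is the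
differential equation.

Linear independence comes from the monodromy `f ↦ f (· + 2πi)`. By Euler's reflection formula the
monodromy minus `exp (2πi b_j)` takes the function with the indices up to `j` in front of the
semicolon to a nonzero multiple of a translate of the function with `j` left out. So the `ℓ`-th
function of a block is a generalized eigenvector of rank exactly `ℓ`, and different blocks have
different eigenvalues. A branch of the logarithm that differs by a constant only translates the
function, and translations commute with the monodromy. Finally, `N` linearly independent solutions
span all solutions, since a solution on a connected open set is determined by its derivatives
of order less than `N` at a point.
-/

namespace EulerMeijer

/-- The operator `∏_{j=1}^N (p d/dz - c_j)` with a coefficient function `p`: it is `eulerProd` for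
`p z = z`, and the constant coefficient operator that replaces it in a logarithmic variable for
`p = 1`. -/
noncomputable def diffProd {N : ℕ} (p : ℂ → ℂ) (c : Fin N → ℂ) (f : ℂ → ℂ) : ℂ → ℂ :=
  (List.ofFn c).foldr (fun c g z => p z * deriv g z - c * g z) f

section DifferentialOperators

theorem diffProd_zero (p : ℂ → ℂ) (c : Fin 0 → ℂ) (f : ℂ → ℂ) : diffProd p c f = f := by
  simp [diffProd]

theorem diffProd_succ {N : ℕ} (p : ℂ → ℂ) (c : Fin (N + 1) → ℂ) (f : ℂ → ℂ) :
    diffProd p c f =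
      fun z => p z * deriv (diffProd p (Fin.tail c) f) z - c 0 * diffProd p (Fin.tail c) f z := by
  simp only [diffProd, List.ofFn_succ, List.foldr_cons, Fin.tail_def]

variable {N : ℕ} {U : Set ℂ} {p : ℂ → ℂ}

theorem differentiableOn_diffProd (hU : IsOpen U) (hp : DifferentiableOn ℂ p U) {f : ℂ → ℂ}
    (hf : DifferentiableOn ℂ f U) (c : Fin N → ℂ) : DifferentiableOn ℂ (diffProd p c f) U := by
  induction N with
  | zero => rwa [diffProd_zero]
  | succ N ih =>
    rw [diffProd_succ]
    exact (hp.mul ((ih _).deriv hU)).sub ((ih _).const_mul _)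

theorem diffProd_sum (hU : IsOpen U) (hp : DifferentiableOn ℂ p U) {ι : Type*} (s : Finset ι)
    (a : ι → ℂ) {f : ι → ℂ → ℂ} (hf : ∀ i ∈ s, DifferentiableOn ℂ (f i) U) (c : Fin N → ℂ) :
    Set.EqOn (diffProd p c fun z => ∑ i ∈ s, a i * f i z)
      (fun z => ∑ i ∈ s, a i * diffProd p c (f i) z) U := by
  induction N with
  | zero => simp only [diffProd_zero, Set.eqOn_refl]
  | succ N ih =>
    intro z hz
    have hderiv := HasDerivAt.fun_sum fun i hi =>
      ((differentiableOn_diffProd hU hp (hf i hi) (Fin.tail c)).differentiableAt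
        (hU.mem_nhds hz)).hasDerivAt.const_mul (a i)
    simp only [diffProd_succ]
    rw [((ih _).eventuallyEq_of_mem (hU.mem_nhds hz)).deriv_eq, hderiv.deriv, ih _ hz,
      Finset.mul_sum, Finset.mul_sum, ← Finset.sum_sub_distrib]
    exact Finset.sum_congr rfl fun i _ => by ring

theorem diffProd_const_mul (hU : IsOpen U) (hp : DifferentiableOn ℂ p U) {f : ℂ → ℂ}
    (hf : DifferentiableOn ℂ f U) (a : ℂ) (c : Fin N → ℂ) :
    Set.EqOn (diffProd p c fun z => a * f z) (fun z => a * diffProd p c f z) U := by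
  simpa using diffProd_sum hU hp {()} (fun _ => a) (f := fun _ => f) (fun _ _ => hf) c

theorem diffProd_sub (hU : IsOpen U) (hp : DifferentiableOn ℂ p U) {f g : ℂ → ℂ}
    (hf : DifferentiableOn ℂ f U) (hg : DifferentiableOn ℂ g U) (c : Fin N → ℂ) :
    Set.EqOn (diffProd p c (f - g)) (diffProd p c f - diffProd p c g) U := by
  have h := diffProd_sum hU hp Finset.univ ![1, -1] (f := ![f, g])
    (fun i _ => by fin_cases i <;> assumption) c
  convert h using 1
  · congr 1
    funext z
    simp [sub_eq_add_neg]
  · funext z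
    simp [sub_eq_add_neg]

theorem diffProd_comp (hU : IsOpen U) {L F : ℂ → ℂ} {m : ℂ} (hL : DifferentiableOn ℂ L U)
    (hLm : ∀ z ∈ U, p z * deriv L z = m) (hF : Differentiable ℂ F) (c : Fin N → ℂ) :
    Set.EqOn (diffProd p (m • c) (F ∘ L)) (fun z => m ^ N * diffProd 1 c F (L z)) U := by
  induction N with
  | zero => simp [diffProd_zero, Set.EqOn]
  | succ N ih =>
    intro z hz
    have hFt : Differentiable ℂ (diffProd 1 (Fin.tail c) F) := differentiableOn_univ.1 <|
      differentiableOn_diffProd isOpen_univ (differentiableOn_const _) hF.differentiableOn _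
    have hderiv := ((hFt (L z)).hasDerivAt.comp z
      (hL.differentiableAt (hU.mem_nhds hz)).hasDerivAt).const_mul (m ^ N)
    have htail : Fin.tail (m • c) = m • Fin.tail c := rfl
    simp only [diffProd_succ, htail, Pi.smul_apply, smul_eq_mul, Pi.one_apply]
    rw [((ih _).eventuallyEq_of_mem (hU.mem_nhds hz)).deriv_eq, ih _ hz]
    simp only [Function.comp_def] at hderiv
    rw [hderiv.deriv]
    linear_combination m ^ N * deriv (diffProd 1 (Fin.tail c) F) (L z) * hLm z hz

theorem tendstoLocallyUniformlyOn_diffProd (hU : IsOpen U) (hp : DifferentiableOn ℂ p U)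
    {ι : Type*} {φ : Filter ι} {F : ι → ℂ → ℂ} {f : ℂ → ℂ}
    (hF : ∀ i, DifferentiableOn ℂ (F i) U) (h : TendstoLocallyUniformlyOn F f φ U)
    (c : Fin N → ℂ) :
    TendstoLocallyUniformlyOn (fun i => diffProd p c (F i)) (diffProd p c f) φ U := by
  induction N with
  | zero => simpa only [diffProd_zero] using h
  | succ N ih =>
    have hdiff (i : ι) := differentiableOn_diffProd hU hp (hF i) (Fin.tail c)
    simp only [diffProd_succ]
    rcases φ.eq_or_neBot with rfl | hφ
    · exact fun _ _ _ _ => ⟨U, self_mem_nhdsWithin, eventually_bot⟩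
    have hlim := (ih (Fin.tail c)).differentiableOn (.of_forall hdiff) hU
    have hconst (g : ℂ → ℂ) : TendstoLocallyUniformlyOn (fun _ : ι => g) g φ U :=
      fun _ hu _ _ => ⟨U, self_mem_nhdsWithin, .of_forall fun _ _ _ => refl_mem_uniformity hu⟩
    exact ((hconst p).mul₀ ((ih (Fin.tail c)).deriv (.of_forall hdiff) hU)
      hp.continuousOn (hlim.deriv hU).continuousOn).sub
        ((hconst _).mul₀ (ih (Fin.tail c)) continuousOn_const hlim.continuousOn)

end DifferentialOperators

section SolutionSpace

variable {N : ℕ} {U : Set ℂ} {p q f : ℂ → ℂ} {z₀ : ℂ}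

theorem analyticOrderAt_mul_deriv_sub (hp : AnalyticAt ℂ p z₀) (hp₀ : p z₀ ≠ 0)
    (hf : AnalyticAt ℂ f z₀) {n : ℕ} (hn : analyticOrderAt f z₀ = n + 1) (c : ℂ) :
    analyticOrderAt (fun z => p z * deriv f z - c * f z) z₀ = n := by
  have hz₀ : f z₀ = 0 := by
    by_contra h
    rw [hf.analyticOrderAt_eq_zero.2 h] at hn
    exact absurd hn.symm (by simp)
  have hderiv : analyticOrderAt (p * deriv f) z₀ = n := by
    have h := hf.analyticOrderAt_deriv_add_one
    simp only [hz₀, sub_zero, hn] at h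
    rw [analyticOrderAt_mul hp hf.deriv, hp.analyticOrderAt_eq_zero.2 hp₀, zero_add]
    simpa using h
  have hconst : (n : ℕ∞) < analyticOrderAt ((fun _ => -c) * f) z₀ := by
    rw [analyticOrderAt_mul analyticAt_const hf, hn]
    exact lt_of_lt_of_le (by exact_mod_cast n.lt_succ_self) le_add_self
  rw [← hderiv, ← analyticOrderAt_add_eq_left_of_lt (hderiv.trans_lt hconst)]
  congr 1
  funext z
  simp [sub_eq_add_neg]

theorem analyticOrderAt_diffProd (hU : IsOpen U) (hp : DifferentiableOn ℂ p U)
    (hf : DifferentiableOn ℂ f U) (hz₀ : z₀ ∈ U) (hp₀ : p z₀ ≠ 0) {n : ℕ}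
    (hn : analyticOrderAt f z₀ = ↑(n + N)) (c : Fin N → ℂ) :
    analyticOrderAt (diffProd p c f) z₀ = n := by
  induction N generalizing n with
  | zero => rwa [diffProd_zero]
  | succ N ih =>
    have htail : analyticOrderAt (diffProd p (Fin.tail c) f) z₀ = ↑(n + 1) :=
      ih (by rw [hn]; congr 1; ring) (Fin.tail c)
    rw [diffProd_succ]
    exact analyticOrderAt_mul_deriv_sub (hp.analyticAt (hU.mem_nhds hz₀)) hp₀
      ((differentiableOn_diffProd hU hp hf _).analyticAt (hU.mem_nhds hz₀)) (by simpa using htail) _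

-- If `f` had finite order `m ≥ N` at `z₀`, then `diffProd p c f = q f` would have order `m - N`.
theorem eqOn_zero_of_iteratedDeriv_eq_zero (hN : 0 < N) (hU : IsOpen U) (hUc : IsPreconnected U)
    (hp : DifferentiableOn ℂ p U) (hq : DifferentiableOn ℂ q U) (hf : DifferentiableOn ℂ f U)
    {c : Fin N → ℂ} (hsol : Set.EqOn (diffProd p c f) (q * f) U) (hz₀ : z₀ ∈ U) (hp₀ : p z₀ ≠ 0)
    (hjet : ∀ k < N, iteratedDeriv k f z₀ = 0) : Set.EqOn f 0 U := by
  have hUz₀ := hU.mem_nhds hz₀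
  have hfa := hf.analyticAt hUz₀
  suffices htop : analyticOrderAt f z₀ = ⊤ from
    (hf.analyticOnNhd hU).eqOn_zero_of_preconnected_of_eventuallyEq_zero hUc hz₀
      (analyticOrderAt_eq_top.1 htop)
  by_contra htop
  obtain ⟨m, hm⟩ := ENat.ne_top_iff_exists.1 htop
  have hNm : N ≤ m := by
    have h := (natCast_le_analyticOrderAt_iff_iteratedDeriv_eq_zero hfa (n := N)).2 hjet
    rw [← hm] at h
    exact_mod_cast h
  obtain ⟨n, rfl⟩ := Nat.exists_eq_add_of_le' hNm
  have hqf := analyticOrderAt_mul (hq.analyticAt hUz₀) hfa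
  rw [← analyticOrderAt_congr (hsol.eventuallyEq_of_mem hUz₀),
    analyticOrderAt_diffProd hU hp hf hz₀ hp₀ hm.symm c, ← hm] at hqf
  have hle : n + N ≤ n := by exact_mod_cast (hqf ▸ le_add_self : ((n + N : ℕ) : ℕ∞) ≤ n)
  omega

theorem iteratedDeriv_sum_const_mul (hU : IsOpen U) {ι : Type*} (s : Finset ι) (a : ι → ℂ)
    {f : ι → ℂ → ℂ} (hf : ∀ i ∈ s, DifferentiableOn ℂ (f i) U) {z : ℂ} (hz : z ∈ U) (k : ℕ) :
    iteratedDeriv k (fun z => ∑ i ∈ s, a i * f i z) z = ∑ i ∈ s, a i * iteratedDeriv k (f i) z := by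
  have hsmooth : ∀ i ∈ s, ContDiffAt ℂ k (f i) z := fun i hi =>
    ((hf i hi).analyticAt (hU.mem_nhds hz)).contDiffAt
  rw [iteratedDeriv_fun_sum fun i hi => contDiffAt_const.mul (hsmooth i hi)]
  exact Finset.sum_congr rfl fun i _ => iteratedDeriv_const_mul_field _ _

theorem exists_eq_sum_of_linearIndependent (hN : 0 < N) (hU : IsOpen U) (hUc : IsConnected U)
    (hp : DifferentiableOn ℂ p U) (hp₀ : ∀ z ∈ U, p z ≠ 0) (hq : DifferentiableOn ℂ q U)
    {c : Fin N → ℂ} {u : Fin N → ℂ → ℂ} (hu : ∀ j, DifferentiableOn ℂ (u j) U)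
    (hus : ∀ j, Set.EqOn (diffProd p c (u j)) (q * u j) U)
    (hli : LinearIndependent ℂ (fun j (z : U) => u j z)) (hf : DifferentiableOn ℂ f U)
    (hfs : Set.EqOn (diffProd p c f) (q * f) U) :
    ∃ a : Fin N → ℂ, ∀ z ∈ U, f z = ∑ j, a j * u j z := by
  obtain ⟨z₀, hz₀⟩ := hUc.nonempty
  let v (a : Fin N → ℂ) (z : ℂ) : ℂ := ∑ j, a j * u j z
  have hv (a : Fin N → ℂ) : DifferentiableOn ℂ (v a) U :=
    DifferentiableOn.fun_sum fun j _ => (hu j).const_mul _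
  have hvs (a : Fin N → ℂ) : Set.EqOn (diffProd p c (v a)) (q * v a) U := fun z hz => by
    rw [diffProd_sum hU hp _ _ (fun j _ => hu j) c hz, Pi.mul_apply, Finset.mul_sum]
    exact Finset.sum_congr rfl fun j _ => by rw [hus j hz, Pi.mul_apply]; ring
  let jet (g : ℂ → ℂ) (k : Fin N) : ℂ := iteratedDeriv k g z₀
  have hvjet (a : Fin N → ℂ) : jet (v a) = ∑ j, a j • jet (u j) := funext fun k => by
    simp [jet, v, iteratedDeriv_sum_const_mul hU _ _ (fun j _ => hu j) hz₀]
  have hzero {g : ℂ → ℂ} (hg : DifferentiableOn ℂ g U) (hgs : Set.EqOn (diffProd p c g) (q * g) U)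
      (hgjet : jet g = 0) : Set.EqOn g 0 U :=
    eqOn_zero_of_iteratedDeriv_eq_zero hN hU hUc.isPreconnected hp hq hg hgs hz₀ (hp₀ z₀ hz₀)
      fun k hk => congrFun hgjet ⟨k, hk⟩
  have hjets : LinearIndependent ℂ fun j => jet (u j) :=
    Fintype.linearIndependent_iff.2 fun a ha => Fintype.linearIndependent_iff.1 hli a <|
      funext fun z => by simpa using hzero (hv a) (hvs a) ((hvjet a).trans ha) z.2
  have hspan := hjets.span_eq_top_of_card_eq_finrank' (by simp)
  obtain ⟨a, ha⟩ := (Submodule.mem_span_range_iff_exists_fun ℂ).1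
    (hspan ▸ Submodule.mem_top : jet f ∈ Submodule.span ℂ (Set.range fun j => jet (u j)))
  refine ⟨a, fun z hz => sub_eq_zero.1 (hzero (hf.sub (hv a)) (fun z hz => ?_) ?_ hz)⟩
  · simp only [diffProd_sub hU hp hf (hv a) c hz, Pi.sub_apply, Pi.mul_apply, hfs hz, hvs a hz]
    ring
  · have hsmooth {g : ℂ → ℂ} (hg : DifferentiableOn ℂ g U) (k : ℕ) : ContDiffAt ℂ k g z₀ :=
      (hg.analyticAt (hU.mem_nhds hz₀)).contDiffAt
    rw [← sub_eq_zero.2 (ha.symm.trans (hvjet a).symm)]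
    exact funext fun k => iteratedDeriv_sub (hsmooth hf k) (hsmooth (hv a) k)

end SolutionSpace

section GeneralizedEigenvectors

variable {K E ι : Type*} [Field K] [AddCommGroup E] [Module K E]

theorem linearIndependent_of_pow_apply_eq_zero [Finite ι] {T : Module.End K E} {r : ι → ℕ}
    (hr : Function.Injective r) {v : ι → E} (hzero : ∀ i, (T ^ (r i + 1)) (v i) = 0)
    (hne : ∀ i, (T ^ r i) (v i) ≠ 0) : LinearIndependent K v := by
  classical
  cases nonempty_fintype ι
  refine Fintype.linearIndependent_iff.2 fun a ha => ?_
  by_contra! hcon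
  obtain ⟨i, hi, hmax⟩ := Finset.exists_max_image {i | a i ≠ 0} r
    (hcon.imp fun i hi => (Finset.mem_filter_univ i).2 hi)
  simp only [Finset.mem_filter_univ] at hi hmax
  have hkill : ∀ j ≠ i, a j • (T ^ r i) (v j) = 0 := by
    intro j hj
    by_cases haj : a j = 0
    · rw [haj, zero_smul]
    · have hlt : r j + 1 ≤ r i := (hmax j haj).lt_of_ne fun h => hj (hr h)
      rw [← Nat.sub_add_cancel hlt, pow_add, Module.End.mul_apply, hzero, map_zero, smul_zero]
  have hsum := congrArg (T ^ r i) ha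
  simp only [map_sum, map_smul, map_zero] at hsum
  rw [Fintype.sum_eq_single i hkill] at hsum
  exact (smul_ne_zero hi (hne i)) hsum

theorem linearIndependent_of_iSupIndep {κ : Type*} {p : κ → Submodule K E} (hp : iSupIndep p)
    (α : ι → κ) {v : ι → E} (hv : ∀ i, v i ∈ p (α i))
    (hli : ∀ k, LinearIndependent K fun i : {i // α i = k} => v i) : LinearIndependent K v := by
  have hspan (k : κ) : Submodule.span K (Set.range fun i : {i // α i = k} => v i) ≤ p k :=
    Submodule.span_le.2 <| by
      rintro _ ⟨⟨i, rfl⟩, rfl⟩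
      exact hv i
  have h := linearIndependent_iUnion_finite hli fun k t _ hk =>
    (hp.disjoint_biSup hk).mono (hspan k) (iSup₂_mono fun k _ => hspan k)
  exact (linearIndependent_equiv (Equiv.sigmaFiberEquiv α)).1 h

theorem linearIndependent_of_genEigenvectors [Finite ι] (T : Module.End K E) {α : ι → K}
    {r : ι → ℕ} (hr : ∀ i j, α i = α j → r i = r j → i = j) {v : ι → E}
    (hzero : ∀ i, ((T - algebraMap K _ (α i)) ^ (r i + 1)) (v i) = 0)
    (hne : ∀ i, ((T - algebraMap K _ (α i)) ^ r i) (v i) ≠ 0) : LinearIndependent K v := by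
  refine linearIndependent_of_iSupIndep T.independent_maxGenEigenspace α
    (fun i => (T.mem_maxGenEigenspace _ _).2 ⟨r i + 1, hzero i⟩) fun μ => ?_
  refine linearIndependent_of_pow_apply_eq_zero (T := T - algebraMap K _ μ)
    (r := fun i : {i // α i = μ} => r i)
    (fun i j h => Subtype.ext (hr i j (i.2.trans j.2.symm) h)) ?_ ?_
  · rintro ⟨i, rfl⟩
    exact hzero i
  · rintro ⟨i, rfl⟩
    exact hne i

end GeneralizedEigenvectors

section CircleIntegrals

open MeasureTheory Metric

theorem hasDerivAt_circleIntegral {E : Type*} [NormedAddCommGroup E] [NormedSpace ℂ E]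
    {F F' : ℂ → ℂ → E} {a w : ℂ} {R : ℝ} (hR : 0 ≤ R)
    (hF : ∀ w, ContinuousOn (F w) (sphere a R))
    (hF' : ContinuousOn (Function.uncurry F') (Set.univ ×ˢ sphere a R))
    (hFF' : ∀ w, ∀ ω ∈ sphere a R, HasDerivAt (F · ω) (F' w ω) w) :
    HasDerivAt (fun w => ∮ ω in C(a, R), F w ω) (∮ ω in C(a, R), F' w ω) w := by
  obtain ⟨M, hM⟩ := ((isCompact_closedBall w 1).prod
    (isCompact_sphere a R)).exists_bound_of_continuousOn
      (hF'.mono (Set.prod_mono_left (Set.subset_univ _)))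
  have hcircle (θ : ℝ) : circleMap a R θ ∈ sphere a R := circleMap_mem_sphere a hR θ
  have hsmul {g : ℂ → E} (hg : ContinuousOn g (sphere a R)) :
      Continuous fun θ : ℝ => deriv (circleMap a R) θ • g (circleMap a R θ) := by
    simp only [deriv_circleMap]
    exact ((continuous_circleMap 0 R).mul continuous_const).smul
      (hg.comp_continuous (continuous_circleMap a R) hcircle)
  have hF'w : ContinuousOn (F' w) (sphere a R) :=
    hF'.comp (f := fun ω => (w, ω)) (by fun_prop) fun ω hω => ⟨Set.mem_univ w, hω⟩
  refine (intervalIntegral.hasDerivAt_integral_of_dominated_loc_of_deriv_le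
    (F' := fun x θ => deriv (circleMap a R) θ • F' x (circleMap a R θ)) (bound := fun _ => R * M)
    (closedBall_mem_nhds w one_pos) (.of_forall fun x => (hsmul (hF x)).aestronglyMeasurable)
    ((hsmul (hF w)).intervalIntegrable _ _) (hsmul hF'w).aestronglyMeasurable
    (.of_forall fun θ _ x hx => ?_) intervalIntegrable_const
    (.of_forall fun θ _ x _ => (hFF' x _ (hcircle θ)).const_smul _)).2
  rw [norm_smul, deriv_circleMap, norm_mul, norm_circleMap_zero, Complex.norm_I, mul_one,
    abs_of_nonneg hR]
  exact mul_le_mul_of_nonneg_left (hM (x, circleMap a R θ) ⟨hx, hcircle θ⟩) hR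

theorem circleIntegral_comp_sub {E : Type*} [NormedAddCommGroup E] [NormedSpace ℂ E] (f : ℂ → E)
    (a c : ℂ) (R : ℝ) : (∮ ω in C(a, R), f (ω - c)) = ∮ ω in C(a - c, R), f ω := by
  simp only [circleIntegral, deriv_circleMap, circleMap, zero_add, sub_add_eq_add_sub]

variable {g : ℂ → ℂ} {a : ℂ} {R : ℝ}

theorem hasDerivAt_circleIntegral_mul_exp (hR : 0 ≤ R) (hg : ContinuousOn g (sphere a R)) (w : ℂ) :
    HasDerivAt (fun w => ∮ ω in C(a, R), g ω * Complex.exp (ω * w))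
      (∮ ω in C(a, R), ω * (g ω * Complex.exp (ω * w))) w := by
  refine hasDerivAt_circleIntegral (F := fun w ω => g ω * Complex.exp (ω * w))
    (F' := fun w ω => ω * (g ω * Complex.exp (ω * w))) hR (fun w => hg.mul (by fun_prop)) ?_
    fun w ω _ => ?_
  · have hg' : ContinuousOn (fun x : ℂ × ℂ => g x.2) (Set.univ ×ˢ sphere a R) :=
      hg.comp continuousOn_snd fun x hx => hx.2
    exact continuousOn_snd.mul (hg'.mul (by fun_prop))
  · exact (((hasDerivAt_id' w).const_mul ω).cexp.const_mul (g ω)).congr_deriv (by ring)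

theorem diffProd_circleIntegral_mul_exp (hR : 0 ≤ R) (hg : ContinuousOn g (sphere a R)) {N : ℕ}
    (c : Fin N → ℂ) :
    diffProd 1 c (fun w => ∮ ω in C(a, R), g ω * Complex.exp (ω * w)) =
      fun w => ∮ ω in C(a, R), (∏ i, (ω - c i)) * g ω * Complex.exp (ω * w) := by
  induction N with
  | zero => simp only [diffProd_zero, Finset.univ_eq_empty, Finset.prod_empty, one_mul]
  | succ N ih =>
    funext w
    have hcont : ContinuousOn (fun ω => (∏ i, (ω - Fin.tail c i)) * g ω) (sphere a R) :=
      (Continuous.continuousOn (by fun_prop)).mul hg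
    have hint : ContinuousOn (fun ω => (∏ i, (ω - Fin.tail c i)) * g ω * Complex.exp (ω * w))
        (sphere a R) := hcont.mul (by fun_prop)
    simp only [diffProd_succ, ih, Pi.one_apply, one_mul]
    rw [(hasDerivAt_circleIntegral_mul_exp hR hcont w).deriv,
      ← circleIntegral.integral_const_mul, ← circleIntegral.integral_sub
        (((continuousOn_id' _).fun_mul hint).circleIntegrable hR)
        ((continuousOn_const.fun_mul hint).circleIntegrable hR)]
    simp only [Fin.prod_univ_succ, Fin.tail, ← sub_mul, mul_assoc]

end CircleIntegrals

section Series

variable {N : ℕ} {U : Set ℂ} {p : ℂ → ℂ} {ι : Type*} {f : ι → ℂ → ℂ} {g : ℂ → ℂ}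

theorem hasSumLocallyUniformlyOn_diffProd (hU : IsOpen U) (hp : DifferentiableOn ℂ p U)
    (hf : ∀ i, DifferentiableOn ℂ (f i) U) (h : HasSumLocallyUniformlyOn f g U) (c : Fin N → ℂ) :
    HasSumLocallyUniformlyOn (fun i => diffProd p c (f i)) (diffProd p c g) U := by
  refine (tendstoLocallyUniformlyOn_diffProd hU hp
    (fun s => DifferentiableOn.fun_sum fun i _ => hf i) h c).congr fun s z hz => ?_
  simpa only [Pi.one_apply, one_mul] using diffProd_sum hU hp s 1 (fun i _ => hf i) c hz

end Series

section GammaKernel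

open Complex Metric

variable {N : ℕ} {b : Fin N → ℂ} {B : Finset (Fin N)} {a β ω : ℂ}

/-- The integrand of `G_{0,N}^{ℓ,0}` without the factor `x ^ ω`. -/
noncomputable def gammaKernel (b : Fin N → ℂ) (B : Finset (Fin N)) (ω : ℂ) : ℂ :=
  (∏ j ∈ B, Gamma (b j - ω)) * ∏ j ∈ Bᶜ, (Gamma (1 - b j + ω))⁻¹

theorem meijerIntegrand_eq_gammaKernel_mul_exp (b : Fin N → ℂ) (B : Finset (Fin N)) (w : ℂ) :
    meijerIntegrand (p := 0) ![] ∅ b B w = fun ω => gammaKernel b B ω * exp (ω * w) := by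
  funext ω
  simp [meijerIntegrand, gammaKernel, div_eq_mul_inv]

theorem gammaKernel_sub_one (hω : ∀ i ∈ B, ω ≠ b i) :
    gammaKernel b B (ω - 1) = (-1) ^ B.card * (∏ i, (ω - b i)) * gammaKernel b B ω := by
  have hnum : ∏ j ∈ B, Gamma (b j - (ω - 1)) =
      ((-1) ^ B.card * ∏ j ∈ B, (ω - b j)) * ∏ j ∈ B, Gamma (b j - ω) := by
    rw [← Finset.prod_const, ← Finset.prod_mul_distrib, ← Finset.prod_mul_distrib]
    refine Finset.prod_congr rfl fun i hi => ?_
    rw [sub_sub_eq_add_sub, add_sub_right_comm, Gamma_add_one _ (sub_ne_zero.2 (hω i hi).symm)]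
    ring
  have hden : ∏ j ∈ Bᶜ, (Gamma (1 - b j + (ω - 1)))⁻¹ =
      (∏ j ∈ Bᶜ, (ω - b j)) * ∏ j ∈ Bᶜ, (Gamma (1 - b j + ω))⁻¹ := by
    rw [← Finset.prod_mul_distrib]
    refine Finset.prod_congr rfl fun i _ => ?_
    rw [show 1 - b i + (ω - 1) = ω - b i by ring,
      one_div_Gamma_eq_self_mul_one_div_Gamma_add_one, show ω - b i + 1 = 1 - b i + ω by ring]
  rw [gammaKernel, hnum, hden, ← Finset.prod_mul_prod_compl B, gammaKernel]
  ring

theorem differentiableAt_gammaKernel (hω : ω ∉ meijerPoles b B) :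
    DifferentiableAt ℂ (gammaKernel b B) ω := by
  refine DifferentiableAt.mul (DifferentiableAt.fun_finsetProd fun i hi => ?_)
    (DifferentiableAt.fun_finsetProd fun i _ => ?_)
  · refine (differentiableAt_Gamma _ fun m hm => hω ⟨i, hi, m, ?_⟩).comp ω (by fun_prop)
    linear_combination -hm
  · exact (differentiable_one_div_Gamma (1 - b i + ω)).comp ω (by fun_prop)

/-- The point `a` is congruent mod `ℤ` to every `b i` with `i ∈ B`, so that no point of
`closedBall a (1 / 2)` other than `a` is a pole of `gammaKernel b B`. -/
def IsCongruent (b : Fin N → ℂ) (B : Finset (Fin N)) (a : ℂ) : Prop :=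
  ∀ i ∈ B, ∃ k : ℤ, b i = a + k

theorem eq_of_mem_closedBall_of_eq_add_intCast (hω : ω ∈ closedBall a (1 / 2)) {k : ℤ}
    (hk : ω = a + k) : ω = a := by
  rw [mem_closedBall_iff_norm, hk, add_sub_cancel_left, norm_intCast] at hω
  have hlt : |(k : ℝ)| < 1 := by linarith
  have hzero : k = 0 := Int.abs_lt_one_iff.1 (by exact_mod_cast hlt)
  rw [hk, hzero, Int.cast_zero, add_zero]

theorem IsCongruent.ne_add_intCast (ha : IsCongruent b B a) (hω : ω ∈ sphere a (1 / 2))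
    {i : Fin N} (hi : i ∈ B) (k : ℤ) : ω ≠ b i + k := by
  obtain ⟨l, hl⟩ := ha i hi
  intro hk
  refine ne_of_mem_sphere hω (by norm_num)
    (eq_of_mem_closedBall_of_eq_add_intCast (sphere_subset_closedBall hω) (k := l + k) ?_)
  rw [hk, hl, Int.cast_add, add_assoc]

theorem IsCongruent.notMem_meijerPoles (ha : IsCongruent b B a) (hω : ω ∈ closedBall a (1 / 2))
    (hne : ω ≠ a) : ω ∉ meijerPoles b B := by
  rintro ⟨i, hi, m, hm⟩
  obtain ⟨k, hk⟩ := ha i hi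
  refine hne (eq_of_mem_closedBall_of_eq_add_intCast hω (k := k + m) ?_)
  rw [hm, hk, Int.cast_add, Int.cast_natCast, add_assoc]

theorem IsCongruent.continuousOn_gammaKernel (ha : IsCongruent b B a) :
    ContinuousOn (gammaKernel b B) (sphere a (1 / 2)) := fun _ hω =>
  (differentiableAt_gammaKernel (ha.notMem_meijerPoles (sphere_subset_closedBall hω)
    (ne_of_mem_sphere hω (by norm_num)))).continuousAt.continuousWithinAt

/-- The contribution of the point `a` to the sum of residues that defines `G_{0,N}^{ℓ,0}`. -/
noncomputable def residueTerm (b : Fin N → ℂ) (B : Finset (Fin N)) (a w : ℂ) : ℂ :=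
  -(2 * Real.pi * I)⁻¹ * ∮ ω in C(a, 1 / 2), gammaKernel b B ω * exp (ω * w)

theorem IsCongruent.residueTerm_eq_zero (ha : IsCongruent b B a) (hpole : a ∉ meijerPoles b B)
    (w : ℂ) : residueTerm b B a w = 0 := by
  have hdiff : ∀ ω ∈ closedBall a (1 / 2),
      DifferentiableAt ℂ (fun ω => gammaKernel b B ω * exp (ω * w)) ω := fun ω hω => by
    refine (differentiableAt_gammaKernel ?_).mul (by fun_prop)
    rcases eq_or_ne ω a with rfl | hne
    exacts [hpole, ha.notMem_meijerPoles hω hne]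
  rw [residueTerm, circleIntegral_eq_zero_of_differentiable_on_off_countable (by norm_num)
    Set.countable_empty (fun ω hω => (hdiff ω hω).continuousAt.continuousWithinAt)
    fun ω hω => hdiff ω (ball_subset_closedBall hω.1), mul_zero]

theorem IsCongruent.residue_eq (ha : IsCongruent b B a) (w : ℂ) :
    residue (meijerIntegrand (p := 0) ![] ∅ b B w) a = -residueTerm b B a w := by
  have hdiff : ∀ ω ∈ closedBall a (1 / 2), ω ≠ a →
      DifferentiableAt ℂ (fun ω => gammaKernel b B ω * exp (ω * w)) ω := fun ω hω hne =>
    (differentiableAt_gammaKernel (ha.notMem_meijerPoles hω hne)).mul (by fun_prop)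
  rw [meijerIntegrand_eq_gammaKernel_mul_exp, residueTerm, neg_mul, neg_neg]
  refine Tendsto.limUnder_eq (tendsto_const_nhds.congr' ?_)
  filter_upwards [Ioo_mem_nhdsGT (show (0 : ℝ) < 1 / 2 by norm_num)] with ρ hρ
  congr 1
  refine circleIntegral_eq_of_differentiable_on_annulus_off_countable hρ.1 hρ.2.le
    Set.countable_empty (fun ω hω => (hdiff ω hω.1 ?_).continuousAt.continuousWithinAt)
    fun ω hω => hdiff ω (ball_subset_closedBall hω.1.1) ?_
  · rintro rfl
    exact hω.2 (mem_ball_self hρ.1)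
  · rintro rfl
    exact hω.1.2 (mem_closedBall_self hρ.1.le)

theorem IsCongruent.indicator_residue (ha : IsCongruent b B a) (w : ℂ) :
    (meijerPoles b B).indicator (residue (meijerIntegrand (p := 0) ![] ∅ b B w)) a =
      -residueTerm b B a w := by
  by_cases h : a ∈ meijerPoles b B
  · rw [Set.indicator_of_mem h, ha.residue_eq]
  · rw [Set.indicator_of_notMem h, ha.residueTerm_eq_zero h, neg_zero]

theorem IsCongruent.differentiable_residueTerm (ha : IsCongruent b B a) :
    Differentiable ℂ (residueTerm b B a) := fun w =>
  ((hasDerivAt_circleIntegral_mul_exp (by norm_num)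
    ha.continuousOn_gammaKernel w).const_mul _).differentiableAt

theorem IsCongruent.diffProd_residueTerm (ha : IsCongruent b B a) (w : ℂ) :
    diffProd 1 b (residueTerm b B a) w =
      (-1) ^ B.card * exp w * residueTerm b B (a - 1) w := by
  have hcirc := ha.continuousOn_gammaKernel
  have hdiff : Differentiable ℂ fun w => ∮ ω in C(a, 1 / 2), gammaKernel b B ω * exp (ω * w) :=
    fun w => (hasDerivAt_circleIntegral_mul_exp one_half_pos.le hcirc w).differentiableAt
  have hconst : diffProd 1 b (residueTerm b B a) w = -(2 * Real.pi * I)⁻¹ *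
      diffProd 1 b (fun w => ∮ ω in C(a, 1 / 2), gammaKernel b B ω * exp (ω * w)) w :=
    diffProd_const_mul isOpen_univ (differentiableOn_const 1) hdiff.differentiableOn _ b
      (Set.mem_univ w)
  rw [hconst, diffProd_circleIntegral_mul_exp one_half_pos.le hcirc, residueTerm, mul_left_comm,
    ← circleIntegral_comp_sub, ← circleIntegral.integral_const_mul ((-1) ^ B.card * exp w)]
  congr 1
  refine circleIntegral.integral_congr one_half_pos.le fun ω hω => ?_
  have hne : ∀ i ∈ B, ω ≠ b i := fun i hi => by simpa using ha.ne_add_intCast hω hi 0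
  have hsq : (-1 : ℂ) ^ B.card * (-1) ^ B.card = 1 := by rw [← mul_pow]; simp
  have hexp : exp w * exp ((ω - 1) * w) = exp (ω * w) := by rw [← exp_add]; ring_nf
  rw [gammaKernel_sub_one hne, ← hexp]
  linear_combination (-(∏ i, (ω - b i)) * gammaKernel b B ω * exp w * exp ((ω - 1) * w)) * hsq

end GammaKernel

section PoleSeries

open Complex Metric

variable {N : ℕ} {b : Fin N → ℂ} {B : Finset (Fin N)} {β : ℂ}

/-- Each `b i`, `i ∈ B`, lies in `β + ℕ`, so that the sum of residues defining `G_{0,N}^{ℓ,0}` can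
be indexed by the points `β + n`, `n = 0, 1, 2, …`. -/
def PolesIn (b : Fin N → ℂ) (B : Finset (Fin N)) (β : ℂ) : Prop :=
  ∀ i ∈ B, ∃ n : ℕ, b i = β + n

theorem PolesIn.isCongruent_add_intCast (hβ : PolesIn b B β) (k : ℤ) : IsCongruent b B (β + k) :=
  fun i hi => by
    obtain ⟨n, hn⟩ := hβ i hi
    exact ⟨n - k, by rw [hn]; push_cast; ring⟩

theorem PolesIn.isCongruent (hβ : PolesIn b B β) : IsCongruent b B β := fun i hi => by
  obtain ⟨n, hn⟩ := hβ i hi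
  exact ⟨n, by rw [hn, Int.cast_natCast]⟩

theorem PolesIn.isCongruent_add_natCast (hβ : PolesIn b B β) (n : ℕ) :
    IsCongruent b B (β + n) := by
  simpa using hβ.isCongruent_add_intCast n

theorem PolesIn.isCongruent_sub_one (hβ : PolesIn b B β) : IsCongruent b B (β - 1) := by
  simpa only [sub_eq_add_neg, Int.cast_neg, Int.cast_one] using hβ.isCongruent_add_intCast (-1)

theorem PolesIn.meijerPoles_subset (hβ : PolesIn b B β) :
    meijerPoles b B ⊆ Set.range fun n : ℕ => β + n := by
  rintro _ ⟨i, hi, m, rfl⟩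
  obtain ⟨k, hk⟩ := hβ i hi
  exact ⟨k + m, by simp only [hk, Nat.cast_add, add_assoc]⟩

theorem PolesIn.sub_one_notMem_meijerPoles (hβ : PolesIn b B β) : β - 1 ∉ meijerPoles b B := by
  intro h
  obtain ⟨n, hn⟩ := hβ.meijerPoles_subset h
  have hsucc : ((n + 1 : ℕ) : ℂ) = 0 := by push_cast; linear_combination hn
  exact n.succ_ne_zero (Nat.cast_eq_zero.1 hsucc)

theorem eventually_le_norm_prod_sub (hN : 0 < N) (b : Fin N → ℂ) {s : Set ℂ}
    (hs : Bornology.IsBounded s) (X : ℝ) :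
    ∀ᶠ n : ℕ in atTop, ∀ ω ∈ s, X ≤ ‖∏ i, (ω + n - b i)‖ := by
  obtain ⟨C, hC⟩ := hs.exists_norm_le
  obtain ⟨n₀, hn₀⟩ := exists_nat_ge (max X 1 + C + ∑ i, ‖b i‖)
  filter_upwards [eventually_ge_atTop n₀] with n hn ω hω
  have hn' : (n₀ : ℝ) ≤ n := by exact_mod_cast hn
  have hfactor : ∀ i, max X 1 ≤ ‖ω + n - b i‖ := fun i => by
    have hb : ‖b i‖ ≤ ∑ i, ‖b i‖ :=
      Finset.single_le_sum (f := fun i => ‖b i‖) (fun _ _ => norm_nonneg _) (Finset.mem_univ i)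
    have htri : (n : ℝ) ≤ ‖ω + n - b i‖ + ‖ω‖ + ‖b i‖ := by
      calc (n : ℝ) = ‖(n : ℂ)‖ := (norm_natCast n).symm
        _ = ‖(ω + n - b i) - ω + b i‖ := by ring_nf
        _ ≤ _ := (norm_add_le _ _).trans (by gcongr; exact norm_sub_le _ _)
    linarith [hC ω hω]
  calc X ≤ max X 1 := le_max_left _ _
    _ ≤ max X 1 ^ N := le_self_pow₀ (le_max_right _ _) hN.ne'
    _ = ∏ _i : Fin N, max X 1 := by simp
    _ ≤ ∏ i, ‖ω + n - b i‖ := Finset.prod_le_prod (fun _ _ => by positivity) fun i _ => hfactor i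
    _ = ‖∏ i, (ω + n - b i)‖ := (norm_prod _ _).symm

theorem add_natCast_mem_sphere {ω : ℂ} {r : ℝ} {n : ℕ} :
    ω + n ∈ sphere (β + n) r ↔ ω ∈ sphere β r := by
  rw [mem_sphere_iff_norm, mem_sphere_iff_norm, add_sub_add_right_eq_sub]

theorem IsCongruent.eventually_norm_gammaKernel_succ_le (hβ : IsCongruent b B β) (hN : 0 < N)
    (X : ℝ) : ∀ᶠ n : ℕ in atTop, ∀ ω ∈ sphere β (1 / 2),
      X * ‖gammaKernel b B (ω + (n + 1 : ℕ))‖ ≤ ‖gammaKernel b B (ω + n)‖ := by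
  filter_upwards [(tendsto_add_atTop_nat 1).eventually
    (eventually_le_norm_prod_sub hN b (isBounded_sphere (x := β) (r := 1 / 2)) X)] with n hn ω hω
  have hne : ∀ i ∈ B, ω + (n + 1 : ℕ) ≠ b i := fun i hi h =>
    hβ.ne_add_intCast hω hi (-(n + 1)) (by push_cast at h ⊢; linear_combination h)
  have hrec := gammaKernel_sub_one hne
  rw [Nat.cast_succ, ← add_assoc, add_sub_cancel_right] at hrec
  rw [hrec, norm_mul, norm_mul, norm_pow, norm_neg, norm_one, one_pow, one_mul]
  have hX := hn ω hω
  push_cast [← add_assoc] at hX ⊢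
  gcongr

/-- The kernel decays faster than every exponential along the circles around `β + n`: by the
recursion for the Gamma function it is divided by about `n ^ N` from one circle to the next. -/
theorem PolesIn.exists_summable_bound (hβ : PolesIn b B β) (hN : 0 < N) :
    ∃ M : ℕ → ℝ, (∀ R : ℝ, Summable fun n => M n * Real.exp (n * R)) ∧
      ∀ n : ℕ, ∀ ω ∈ sphere (β + n) (1 / 2), ‖gammaKernel b B ω‖ ≤ M n := by
  have hmax : ∀ n : ℕ, ∃ z ∈ sphere β (1 / 2), ∀ ω ∈ sphere β (1 / 2),
      ‖gammaKernel b B (ω + n)‖ ≤ ‖gammaKernel b B (z + n)‖ := fun n =>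
    (isCompact_sphere β (1 / 2)).exists_isMaxOn (NormedSpace.sphere_nonempty.2 (by norm_num))
      ((hβ.isCongruent_add_natCast n).continuousOn_gammaKernel.comp (by fun_prop)
        fun _ => add_natCast_mem_sphere.2).norm
  choose z hz hmax using hmax
  refine ⟨fun n => ‖gammaKernel b B (z n + n)‖, fun R => ?_, fun n ω hω => ?_⟩
  · refine summable_of_ratio_norm_eventually_le (r := 1 / 2) (by norm_num) ?_
    filter_upwards [hβ.isCongruent.eventually_norm_gammaKernel_succ_le hN (2 * Real.exp R)]
      with n hn
    have hstep := (hn _ (hz (n + 1))).trans (hmax n _ (hz (n + 1)))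
    have hexp : Real.exp ((n + 1 : ℕ) * R) = Real.exp R * Real.exp (n * R) := by
      rw [← Real.exp_add]
      push_cast
      ring_nf
    rw [Real.norm_of_nonneg (by positivity), Real.norm_of_nonneg (by positivity), hexp]
    linarith [mul_le_mul_of_nonneg_right hstep (Real.exp_pos (n * R)).le]
  · rw [← sub_add_cancel ω (n : ℂ), add_natCast_mem_sphere] at hω
    simpa using hmax n _ hω

theorem norm_residueTerm_le {a w : ℂ} {R C : ℝ} (hw : ‖w‖ ≤ R)
    (hC : ∀ ω ∈ sphere a (1 / 2), ‖gammaKernel b B ω‖ ≤ C) :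
    ‖residueTerm b B a w‖ ≤ 1 / 2 * (C * Real.exp ((‖a‖ + 1 / 2) * R)) := by
  rw [residueTerm, neg_mul, norm_neg]
  refine circleIntegral.norm_two_pi_i_inv_smul_integral_le_of_norm_le_const one_half_pos.le
    fun ω hω => ?_
  have hωnorm : ‖ω‖ ≤ ‖a‖ + 1 / 2 := by
    calc ‖ω‖ = ‖a + (ω - a)‖ := by rw [add_sub_cancel]
      _ ≤ ‖a‖ + ‖ω - a‖ := norm_add_le _ _
      _ = ‖a‖ + 1 / 2 := by rw [mem_sphere_iff_norm.1 hω]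
  rw [norm_mul]
  refine mul_le_mul (hC ω hω) ((norm_exp_le_exp_norm _).trans (Real.exp_le_exp.2 ?_))
    (norm_nonneg _) ((norm_nonneg _).trans (hC ω hω))
  rw [norm_mul]
  gcongr

theorem PolesIn.summableLocallyUniformlyOn_residueTerm (hβ : PolesIn b B β) :
    SummableLocallyUniformlyOn (fun n : ℕ => residueTerm b B (β + n)) Set.univ := by
  refine SummableLocallyUniformlyOn_of_locally_bounded isOpen_univ fun K _ hK => ?_
  rcases N.eq_zero_or_pos with rfl | hN
  · refine ⟨0, summable_zero, fun n w _ => ?_⟩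
    rw [(hβ.isCongruent_add_natCast n).residueTerm_eq_zero (fun ⟨i, _⟩ => i.elim0), norm_zero,
      Pi.zero_apply]
  obtain ⟨M, hM, hbound⟩ := hβ.exists_summable_bound hN
  obtain ⟨R, hR⟩ := hK.isBounded.exists_norm_le
  refine ⟨fun n => Real.exp ((‖β‖ + 1 / 2) * R) / 2 * (M n * Real.exp (n * R)),
    (hM R).mul_left _, fun n w hw => (norm_residueTerm_le (hR w hw) (hbound n)).trans ?_⟩
  have hR₀ : 0 ≤ R := (norm_nonneg w).trans (hR w hw)
  have hM₀ : 0 ≤ M n := (norm_nonneg _).trans <| hbound n (β + n + (1 / 2 : ℝ)) <| by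
    rw [mem_sphere_iff_norm, add_sub_cancel_left, norm_real, Real.norm_of_nonneg one_half_pos.le]
  have hnorm : ‖β + n‖ ≤ ‖β‖ + n := by simpa only [norm_natCast] using norm_add_le β (n : ℂ)
  have hexponent : (‖β + n‖ + 1 / 2) * R ≤ (‖β‖ + 1 / 2) * R + n * R := by
    rw [← add_mul]
    exact mul_le_mul_of_nonneg_right (by linarith) hR₀
  calc 1 / 2 * (M n * Real.exp ((‖β + n‖ + 1 / 2) * R))
      ≤ 1 / 2 * (M n * Real.exp ((‖β‖ + 1 / 2) * R + n * R)) := by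
        gcongr
    _ = Real.exp ((‖β‖ + 1 / 2) * R) / 2 * (M n * Real.exp (n * R)) := by
        rw [Real.exp_add]
        ring

/-- The function `G_{0,N}^{ℓ,0}` with the parameters `b i`, `i ∈ B`, in front of the semicolon, in
the logarithmic variable. -/
noncomputable def frontG (b : Fin N → ℂ) (B : Finset (Fin N)) : ℂ → ℂ :=
  meijerG (p := 0) ![] ∅ b B

theorem PolesIn.support_indicator_residue_subset (hβ : PolesIn b B β) (f : ℂ → ℂ) :
    Function.support ((meijerPoles b B).indicator f) ⊆ Set.range fun n : ℕ => β + n :=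
  Set.support_indicator_subset.trans hβ.meijerPoles_subset

theorem add_natCast_injective (β : ℂ) : Function.Injective fun n : ℕ => β + (n : ℂ) :=
  (add_right_injective β).comp Nat.cast_injective

theorem PolesIn.hasSumLocallyUniformlyOn_frontG (hβ : PolesIn b B β) :
    HasSumLocallyUniformlyOn (fun n : ℕ => residueTerm b B (β + n)) (frontG b B) Set.univ := by
  refine hβ.summableLocallyUniformlyOn_residueTerm.hasSumLocallyUniformlyOn.congr_right ?_
  intro w _
  have hterm := fun n : ℕ => (hβ.isCongruent_add_natCast n).indicator_residue w
  rw [frontG, meijerG, tsum_subtype (meijerPoles b B) (residue _),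
    ← (add_natCast_injective β).tsum_eq (hβ.support_indicator_residue_subset _)]
  simp only [hterm, tsum_neg, neg_neg]

theorem PolesIn.hasSum_frontG (hβ : PolesIn b B β) (w : ℂ) :
    HasSum (fun n : ℕ => residueTerm b B (β + n) w) (frontG b B w) :=
  hβ.hasSumLocallyUniformlyOn_frontG.hasSum (Set.mem_univ w)

theorem PolesIn.summable_norm_residue (hβ : PolesIn b B β) (w : ℂ) :
    Summable fun ω : meijerPoles b B =>
      ‖residue (meijerIntegrand (p := 0) ![] ∅ b B w) ω‖ := by
  have hterm := fun n : ℕ => (hβ.isCongruent_add_natCast n).indicator_residue w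
  refine Summable.norm ?_
  rw [← Function.comp_def, summable_subtype_iff_indicator, ← (add_natCast_injective β).summable_iff
    fun ω hω => Function.notMem_support.1 fun h => hω (hβ.support_indicator_residue_subset _ h)]
  exact (hβ.hasSum_frontG w).summable.neg.congr fun n => (hterm n).symm

theorem PolesIn.differentiable_frontG (hβ : PolesIn b B β) : Differentiable ℂ (frontG b B) := by
  rw [← differentiableOn_univ]
  exact (hβ.summableLocallyUniformlyOn_residueTerm.differentiableOn isOpen_univ fun n w _ =>
    (hβ.isCongruent_add_natCast n).differentiable_residueTerm w).congr
      fun w _ => (hβ.hasSum_frontG w).tsum_eq.symm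

theorem PolesIn.diffProd_frontG (hβ : PolesIn b B β) (w : ℂ) :
    diffProd 1 b (frontG b B) w = (-1) ^ B.card * exp w * frontG b B w := by
  have hsum : HasSum (fun n : ℕ => diffProd 1 b (residueTerm b B (β + n)) w)
      (diffProd 1 b (frontG b B) w) :=
    (hasSumLocallyUniformlyOn_diffProd isOpen_univ (differentiableOn_const 1)
      (fun n => (hβ.isCongruent_add_natCast n).differentiable_residueTerm.differentiableOn)
      hβ.hasSumLocallyUniformlyOn_frontG b).hasSum (Set.mem_univ w)
  simp only [(hβ.isCongruent_add_natCast _).diffProd_residueTerm] at hsum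
  rw [← hasSum_nat_add_iff' 1] at hsum
  have hzero := hβ.isCongruent_sub_one.residueTerm_eq_zero hβ.sub_one_notMem_meijerPoles w
  simp only [Nat.cast_succ, ← add_assoc, add_sub_cancel_right, Finset.sum_range_one,
    Nat.cast_zero, add_zero, hzero, mul_zero, sub_zero] at hsum
  exact hsum.unique ((hβ.hasSum_frontG w).mul_left _)

end PoleSeries

section Monodromy

open Complex Metric

/-- The translation `f ↦ f (· + a)`; the monodromy operator is `shift (2 * π * I)`. -/
def shift (a : ℂ) : Module.End ℂ (ℂ → ℂ) := LinearMap.funLeft ℂ ℂ (· + a)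

@[simp]
theorem shift_apply (a : ℂ) (f : ℂ → ℂ) (w : ℂ) : shift a f w = f (w + a) := rfl

theorem commute_shift (a a' : ℂ) : Commute (shift a) (shift a') := by
  refine LinearMap.ext fun f => funext fun w => ?_
  simp only [Module.End.mul_apply, shift_apply, add_right_comm]

theorem shift_injective (a : ℂ) : Function.Injective (shift a) := fun f g h => funext fun w => by
  simpa using congrFun h (w - a)

theorem pow_shift_sub_apply_shift (α a a' : ℂ) (m : ℕ) (f : ℂ → ℂ) :
    ((shift a - algebraMap ℂ _ α) ^ m) (shift a' f) =
      shift a' (((shift a - algebraMap ℂ _ α) ^ m) f) := by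
  have h : Commute ((shift a - algebraMap ℂ _ α) ^ m) (shift a') :=
    ((commute_shift a a').sub_left (Algebra.commutes α (shift a'))).pow_left m
  exact LinearMap.congr_fun h.eq f

variable {N : ℕ} {b : Fin N → ℂ} {B : Finset (Fin N)} {a β ω : ℂ} {j : Fin N}

theorem gammaKernel_insert (hj : j ∉ B) (hω : Gamma (1 - b j + ω) ≠ 0) :
    gammaKernel b (insert j B) ω =
      gammaKernel b B ω * (Gamma (b j - ω) * Gamma (1 - b j + ω)) := by
  rw [gammaKernel, gammaKernel, Finset.prod_insert hj, Finset.compl_insert,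
    ← Finset.mul_prod_erase Bᶜ _ (Finset.mem_compl.2 hj)]
  field_simp

theorem exp_mul_two_pi_I_sub_exp_mul_two_pi_I (z ω : ℂ) :
    exp (ω * (2 * Real.pi * I)) - exp (z * (2 * Real.pi * I)) =
      -(2 * I) * exp (Real.pi * I * z) * exp (ω * (Real.pi * I)) * sin (Real.pi * (z - ω)) := by
  have hleft : exp (ω * (2 * Real.pi * I)) = exp (Real.pi * I * z) * exp (ω * (Real.pi * I)) *
      exp (-(Real.pi * (z - ω)) * I) := by
    rw [← exp_add, ← exp_add]
    ring_nf
  have hright : exp (z * (2 * Real.pi * I)) = exp (Real.pi * I * z) * exp (ω * (Real.pi * I)) *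
      exp (Real.pi * (z - ω) * I) := by
    rw [← exp_add, ← exp_add]
    ring_nf
  rw [hleft, hright, sin]
  linear_combination (exp (Real.pi * I * z) * exp (ω * (Real.pi * I)) *
    (exp (-(Real.pi * (z - ω)) * I) - exp (Real.pi * (z - ω) * I))) * I_sq

/-- Moving a parameter in front of the semicolon multiplies the kernel by `π / sin (π (b j - ω))`
(Euler's reflection formula), and the monodromy operator removes this factor again. -/
theorem gammaKernel_insert_mul (hj : j ∉ B) (hω : ∀ n : ℤ, ω ≠ b j + n) :
    gammaKernel b (insert j B) ω * (exp (ω * (2 * Real.pi * I)) - exp (b j * (2 * Real.pi * I))) =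
      -(2 * Real.pi * I) * exp (Real.pi * I * b j) *
        (gammaKernel b B ω * exp (ω * (Real.pi * I))) := by
  have hleft : Gamma (b j - ω) ≠ 0 := Gamma_ne_zero fun m hm => hω m (by
    push_cast
    linear_combination -hm)
  have hright : Gamma (1 - b j + ω) ≠ 0 := Gamma_ne_zero fun m hm => hω (-(m + 1)) (by
    push_cast
    linear_combination hm)
  have hrefl := Gamma_mul_Gamma_one_sub (b j - ω)
  rw [← sub_add] at hrefl
  have hsin : sin (Real.pi * (b j - ω)) ≠ 0 := fun h =>
    mul_ne_zero hleft hright (by rw [hrefl, h, div_zero])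
  rw [gammaKernel_insert hj hright, hrefl, exp_mul_two_pi_I_sub_exp_mul_two_pi_I]
  field_simp

theorem IsCongruent.monodromy_residueTerm (hj : j ∉ B) (ha : IsCongruent b (insert j B) a)
    (w : ℂ) :
    residueTerm b (insert j B) a (w + 2 * Real.pi * I) -
        exp (b j * (2 * Real.pi * I)) * residueTerm b (insert j B) a w =
      -(2 * Real.pi * I) * exp (Real.pi * I * b j) * residueTerm b B a (w + Real.pi * I) := by
  have hcont : ∀ v : ℂ, ContinuousOn (fun ω => gammaKernel b (insert j B) ω * exp (ω * v))
      (sphere a (1 / 2)) := fun v => ha.continuousOn_gammaKernel.fun_mul (by fun_prop)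
  simp only [residueTerm]
  rw [mul_left_comm, ← mul_sub, mul_left_comm (_ * _),
    ← circleIntegral.integral_const_mul (exp _), ← circleIntegral.integral_const_mul (_ * _),
    ← circleIntegral.integral_sub ((hcont _).circleIntegrable one_half_pos.le)
      ((continuousOn_const.fun_mul (hcont w)).circleIntegrable one_half_pos.le)]
  congr 1
  refine circleIntegral.integral_congr one_half_pos.le fun ω hω => ?_
  have hker := gammaKernel_insert_mul hj (ha.ne_add_intCast hω (Finset.mem_insert_self j B))
  simp only [mul_add, exp_add]
  linear_combination exp (ω * w) * hker

theorem PolesIn.mono {B' : Finset (Fin N)} (hβ : PolesIn b B β) (h : B' ⊆ B) : PolesIn b B' β :=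
  fun i hi => hβ i (h hi)

theorem PolesIn.monodromy_frontG (hj : j ∉ B) (hβ : PolesIn b (insert j B) β) :
    (shift (2 * Real.pi * I) - algebraMap ℂ _ (exp (b j * (2 * Real.pi * I))))
        (frontG b (insert j B)) =
      (-(2 * Real.pi * I) * exp (Real.pi * I * b j)) • shift (Real.pi * I) (frontG b B) := by
  funext w
  simp only [LinearMap.sub_apply, Module.algebraMap_end_apply, Pi.sub_apply, Pi.smul_apply,
    shift_apply, smul_eq_mul]
  refine (((hβ.hasSum_frontG (w + 2 * Real.pi * I)).sub
    ((hβ.hasSum_frontG w).mul_left _))).unique ?_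
  simp only [(hβ.isCongruent_add_natCast _).monodromy_residueTerm hj]
  exact ((hβ.mono (Finset.subset_insert j B)).hasSum_frontG (w + Real.pi * I)).mul_left _

theorem frontG_empty (b : Fin N → ℂ) : frontG b ∅ = 0 := by
  funext w
  have hempty : meijerPoles b ∅ = ∅ := by simp [meijerPoles]
  rw [frontG, meijerG, tsum_subtype, hempty, Set.indicator_empty, tsum_zero, neg_zero,
    Pi.zero_apply]

end Monodromy

section SingleFrontParameter

open Complex Metric

theorem tendsto_add_natCast_mul_Gamma (n : ℕ) :
    Tendsto (fun s : ℂ => (s + n) * Gamma s) (𝓝[≠] (-n)) (𝓝 ((-1) ^ n / n.factorial)) := by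
  induction n with
  | zero => simpa using tendsto_self_mul_Gamma_nhds_zero
  | succ n ih =>
    have hne : -((n + 1 : ℕ) : ℂ) ≠ 0 := neg_ne_zero.2 (Nat.cast_ne_zero.2 n.succ_ne_zero)
    have hshift : Tendsto (fun s : ℂ => s + 1) (𝓝[≠] (-(n + 1 : ℕ))) (𝓝[≠] (-n)) := by
      refine tendsto_nhdsWithin_iff.2 ⟨?_, ?_⟩
      · refine (Continuous.tendsto' (by fun_prop) _ _ ?_).mono_left nhdsWithin_le_nhds
        push_cast
        ring
      · filter_upwards [self_mem_nhdsWithin] with s hs h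
        refine hs (eq_neg_of_add_eq_zero_left ?_)
        push_cast
        linear_combination Set.mem_singleton_iff.1 h
    have hinv : Tendsto (fun s : ℂ => s⁻¹) (𝓝[≠] (-(n + 1 : ℕ))) (𝓝 (-(n + 1 : ℕ))⁻¹) :=
      (continuousAt_inv₀ hne).tendsto.mono_left nhdsWithin_le_nhds
    have hlim := (ih.comp hshift).mul hinv
    have hval : (-1 : ℂ) ^ n / n.factorial * (-((n + 1 : ℕ) : ℂ))⁻¹ =
        (-1) ^ (n + 1) / (n + 1).factorial := by
      rw [Nat.factorial_succ, Nat.cast_mul, pow_succ, inv_neg]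
      field_simp
    rw [hval] at hlim
    refine hlim.congr' ?_
    filter_upwards [nhdsWithin_le_nhds (eventually_ne_nhds hne)] with s hs
    rw [Function.comp_apply, Gamma_add_one s hs]
    push_cast
    field_simp
    ring

variable {N : ℕ} {b : Fin N → ℂ} {j : Fin N}

/-- The coefficient of `x ^ (b j + n)` in `G_{0,N}^{1,0}` with the parameter `b j` in front. -/
noncomputable def singleCoeff (b : Fin N → ℂ) (j : Fin N) (n : ℕ) : ℂ :=
  (-1) ^ n / n.factorial * ∏ i ∈ {j}ᶜ, (Gamma (1 - b i + (b j + n)))⁻¹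

theorem polesIn_singleton (b : Fin N → ℂ) (j : Fin N) : PolesIn b {j} (b j) := fun i hi =>
  ⟨0, by rw [Finset.mem_singleton.1 hi, Nat.cast_zero, add_zero]⟩

theorem tendsto_sub_mul_gammaKernel_singleton (b : Fin N → ℂ) (j : Fin N) (n : ℕ) :
    Tendsto (fun ω => (ω - (b j + n)) * gammaKernel b {j} ω) (𝓝[≠] (b j + n))
      (𝓝 (-singleCoeff b j n)) := by
  have hsub : Tendsto (fun ω => b j - ω) (𝓝[≠] (b j + n)) (𝓝[≠] (-n)) := by
    refine tendsto_nhdsWithin_iff.2 ⟨?_, ?_⟩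
    · exact (Continuous.tendsto' (by fun_prop) _ _ (by ring)).mono_left nhdsWithin_le_nhds
    · filter_upwards [self_mem_nhdsWithin] with ω hω h
      exact hω (Set.mem_singleton_iff.2 (by linear_combination -Set.mem_singleton_iff.1 h))
  have hfactor : Continuous fun ω => ∏ i ∈ ({j} : Finset (Fin N))ᶜ, (Gamma (1 - b i + ω))⁻¹ :=
    continuous_finsetProd _ fun i _ =>
      differentiable_one_div_Gamma.continuous.comp (continuous_const.add continuous_id)
  refine ((((tendsto_add_natCast_mul_Gamma n).comp hsub).mul
    (hfactor.continuousAt.tendsto.mono_left nhdsWithin_le_nhds)).neg).congr fun ω => ?_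
  rw [Function.comp_apply, gammaKernel, Finset.prod_singleton]
  ring

theorem residueTerm_singleton (b : Fin N → ℂ) (j : Fin N) (n : ℕ) (w : ℂ) :
    residueTerm b {j} (b j + n) w = singleCoeff b j n * exp ((b j + n) * w) := by
  have hcongr := (polesIn_singleton b j).isCongruent_add_natCast n
  have hdiff : ∀ ω ∈ closedBall (b j + n) (1 / 2) \ {b j + (n : ℂ)}, DifferentiableAt ℂ
      (fun ω => (ω - (b j + n)) * gammaKernel b {j} ω * exp (ω * w)) ω := fun ω hω =>
    (DifferentiableAt.mul (by fun_prop) (differentiableAt_gammaKernel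
      (hcongr.notMem_meijerPoles hω.1 hω.2))).mul (by fun_prop)
  have hcauchy := circleIntegral_sub_center_inv_smul_of_differentiable_on_off_countable_of_tendsto
    one_half_pos Set.countable_empty (fun ω hω => (hdiff ω hω).continuousAt.continuousWithinAt)
    (fun ω hω => hdiff ω ⟨ball_subset_closedBall hω.1.1, hω.1.2⟩)
    ((tendsto_sub_mul_gammaKernel_singleton b j n).mul
      ((Continuous.tendsto (f := fun ω => exp (ω * w)) (by fun_prop) _).mono_left
        nhdsWithin_le_nhds))
  have hintegrand : (∮ ω in C(b j + n, 1 / 2), gammaKernel b {j} ω * exp (ω * w)) =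
      ∮ ω in C(b j + n, 1 / 2), (ω - (b j + n))⁻¹ •
        ((ω - (b j + n)) * gammaKernel b {j} ω * exp (ω * w)) :=
    circleIntegral.integral_congr one_half_pos.le fun ω hω => by
      have hne : ω - (b j + n) ≠ 0 := sub_ne_zero.2 (ne_of_mem_sphere hω one_half_pos.ne')
      rw [smul_eq_mul, mul_assoc, inv_mul_cancel_left₀ hne]
  rw [residueTerm, hintegrand, hcauchy, smul_eq_mul, neg_mul,
    inv_mul_cancel_left₀ two_pi_I_ne_zero, neg_mul, neg_neg]

theorem hasSum_frontG_singleton (b : Fin N → ℂ) (j : Fin N) (w : ℂ) :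
    HasSum (fun n : ℕ => singleCoeff b j n * exp ((b j + n) * w)) (frontG b {j} w) := by
  simpa only [residueTerm_singleton] using (polesIn_singleton b j).hasSum_frontG w

/-- As `w → -∞` the leading term `singleCoeff b j 0 * exp (b j * w)` dominates. -/
theorem frontG_singleton_ne_zero (hj : ∀ i ≠ j, ∀ m : ℕ, 1 - b i + b j ≠ -m) :
    frontG b {j} ≠ 0 := by
  intro hzero
  have hsum : ∀ x : ℝ, ∑' n : ℕ, singleCoeff b j n * exp (n * x) = 0 := fun x => by
    have h := (hasSum_frontG_singleton b j x).mul_left (exp (-(b j * x)))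
    rw [hzero, Pi.zero_apply, mul_zero] at h
    refine Eq.trans (tsum_congr fun n => ?_) h.tsum_eq
    rw [add_mul, exp_add, exp_neg, mul_left_comm, inv_mul_cancel_left₀ (exp_ne_zero _)]
  have hsummable : Summable fun n => ‖singleCoeff b j n‖ := by
    simpa using (hasSum_frontG_singleton b j 0).summable.norm
  have hlim : Tendsto (fun x : ℝ => ∑' n : ℕ, singleCoeff b j n * exp (n * x)) atBot
      (𝓝 (∑' n : ℕ, if n = 0 then singleCoeff b j 0 else 0)) := by
    refine tendsto_tsum_of_dominated_convergence hsummable (fun n => ?_) ?_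
    · rcases n.eq_zero_or_pos with rfl | hn
      · simp
      · have hexp : Tendsto (fun x : ℝ => exp (n * x)) atBot (𝓝 0) := by
          refine tendsto_exp_nhds_zero_iff.2 ?_
          simpa using tendsto_id.const_mul_atBot (Nat.cast_pos.2 hn : (0 : ℝ) < n)
        simpa [hn.ne'] using hexp.const_mul (singleCoeff b j n)
    · filter_upwards [eventually_le_atBot 0] with x hx n
      rw [norm_mul, norm_exp]
      refine mul_le_of_le_one_right (norm_nonneg _) (Real.exp_le_one_iff.2 ?_)
      simpa using mul_nonpos_of_nonneg_of_nonpos n.cast_nonneg hx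
  simp only [hsum, tsum_ite_eq] at hlim
  have hcoeff := tendsto_nhds_unique hlim tendsto_const_nhds
  simp only [singleCoeff, pow_zero, Nat.factorial_zero, Nat.cast_one, div_one, Nat.cast_zero,
    add_zero, one_mul, Finset.prod_eq_zero_iff, inv_eq_zero] at hcoeff
  obtain ⟨i, hi, h⟩ := hcoeff
  exact Gamma_ne_zero (hj i (by simpa using hi)) h

theorem singleCoeff_eq (hj : ∀ i ≠ j, ∀ m : ℕ, 1 - b i + b j ≠ -m) (n : ℕ) :
    singleCoeff b j n = (∏ i, Gamma (1 + (b j - b i)))⁻¹ * ((-1) ^ n / n.factorial *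
      (∏ i : {i : Fin N // i ≠ j}, (ascPochhammer ℂ n).eval (1 + (b j - b i)))⁻¹) := by
  have hsingle : ∏ i, Gamma (1 + (b j - b i)) = ∏ i ∈ {j}ᶜ, Gamma (1 + (b j - b i)) := by
    rw [← Finset.prod_mul_prod_compl {j}, Finset.prod_singleton, sub_self, add_zero, Gamma_one,
      one_mul]
  have hfactor : ∀ i ∈ ({j} : Finset (Fin N))ᶜ, (Gamma (1 - b i + (b j + n)))⁻¹ =
      (Gamma (1 + (b j - b i)))⁻¹ * ((ascPochhammer ℂ n).eval (1 + (b j - b i)))⁻¹ := by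
    intro i hi
    have hne : ∀ m : ℕ, 1 + (b j - b i) ≠ -m := fun m hm =>
      hj i (by simpa using hi) m (by linear_combination hm)
    rw [← Gamma_add_nat_div_Gamma_eq _ hne, inv_div, ← mul_div_assoc,
      inv_mul_cancel₀ (Gamma_ne_zero hne), one_div]
    ring_nf
  rw [singleCoeff, Finset.prod_congr rfl hfactor, Finset.prod_mul_distrib, hsingle,
    ← Finset.prod_subtype {j}ᶜ (by simp) fun i => (ascPochhammer ℂ n).eval (1 + (b j - b i)),
    ← Finset.prod_inv_distrib, ← Finset.prod_inv_distrib]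
  ring

theorem frontG_singleton_eq_genHypergeometric (hj : ∀ i ≠ j, ∀ m : ℕ, 1 - b i + b j ≠ -m)
    {ζ w : ℂ} (hw : exp w = -ζ) :
    frontG b {j} w = exp (b j * w) / (∏ i, Gamma (1 + (b j - b i))) *
      genHypergeometric (![] : Fin 0 → ℂ)
        (fun i : {i : Fin N // i ≠ j} => 1 + (b j - b i)) ζ := by
  rw [← (hasSum_frontG_singleton b j w).tsum_eq, genHypergeometric, ← tsum_mul_left]
  refine tsum_congr fun n => ?_
  have hpow : (-1 : ℂ) ^ n * exp (n * w) = ζ ^ n := by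
    rw [exp_nat_mul, hw, ← mul_pow, neg_one_mul, neg_neg]
  simp only [singleCoeff_eq hj, add_mul, exp_add, ← hpow, Finset.univ_eq_empty, Finset.prod_empty]
  ring

end SingleFrontParameter

section Blocks

open Complex

variable {N : ℕ} {lam : Fin N → ℂ} {c : Composition N} {i j : Fin N}

theorem mem_blockPrefix : i ∈ blockPrefix c j ↔ c.index i = c.index j ∧ i ≤ j :=
  Finset.mem_filter_univ i

theorem self_mem_blockPrefix (c : Composition N) (j : Fin N) : j ∈ blockPrefix c j :=
  mem_blockPrefix.2 ⟨rfl, le_rfl⟩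

theorem blockPos_pos (c : Composition N) (j : Fin N) : 0 < blockPos c j :=
  Finset.card_pos.2 ⟨j, self_mem_blockPrefix c j⟩

theorem blockPos_lt_blockPos (h : c.index i = c.index j) (hij : i < j) :
    blockPos c i < blockPos c j := by
  refine Finset.card_lt_card ((Finset.ssubset_iff_of_subset fun k hk => ?_).2
    ⟨j, self_mem_blockPrefix c j, fun hj => (mem_blockPrefix.1 hj).2.not_gt hij⟩)
  obtain ⟨hki, hle⟩ := mem_blockPrefix.1 hk
  exact mem_blockPrefix.2 ⟨hki.trans h, hle.trans hij.le⟩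

theorem eq_of_blockPos_eq (h : c.index i = c.index j) (hpos : blockPos c i = blockPos c j) :
    i = j := by
  rcases lt_trichotomy i j with hlt | heq | hlt
  · exact absurd hpos (blockPos_lt_blockPos h hlt).ne
  · exact heq
  · exact absurd hpos (blockPos_lt_blockPos h.symm hlt).ne'

theorem blockPrefix_eq_singleton (h : blockPos c j = 1) : blockPrefix c j = {j} := by
  obtain ⟨i, hi⟩ := Finset.card_eq_one.1 h
  have hj := self_mem_blockPrefix c j
  rw [hi, Finset.mem_singleton] at hj
  rw [hi, hj]

theorem exists_blockPrefix_eq_insert (h : 1 < blockPos c j) :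
    ∃ i, c.index i = c.index j ∧ j ∉ blockPrefix c i ∧
      blockPrefix c j = insert j (blockPrefix c i) := by
  have hne : ((blockPrefix c j).erase j).Nonempty := by
    rw [← Finset.card_pos, Finset.card_erase_of_mem (self_mem_blockPrefix c j)]
    exact Nat.sub_pos_of_lt h
  obtain ⟨i, hi, hmax⟩ := Finset.exists_max_image _ id hne
  simp only [Finset.mem_erase, mem_blockPrefix, id_eq] at hi hmax
  have hlt : i < j := hi.2.2.lt_of_ne hi.1
  refine ⟨i, hi.2.1, fun hj => (mem_blockPrefix.1 hj).2.not_gt hlt, Finset.ext fun k => ?_⟩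
  rw [Finset.mem_insert, mem_blockPrefix, mem_blockPrefix, hi.2.1]
  constructor
  · rintro ⟨hk, hkj⟩
    exact or_iff_not_imp_left.2 fun hne => ⟨hk, hmax k ⟨hne, hk, hkj⟩⟩
  · rintro (rfl | ⟨hk, hki⟩)
    · exact ⟨rfl, le_rfl⟩
    · exact ⟨hk, hki.trans hlt.le⟩

namespace IsCongruenceGrouping

theorem exists_natCast (hc : IsCongruenceGrouping lam c) (h : c.index i = c.index j)
    (hij : i ≤ j) : ∃ n : ℕ, lam i / N = lam j / N + n := by
  obtain ⟨k, hk⟩ := (hc.1 i j).1 h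
  have hre : ((lam i - lam j) / N).re = ((lam i).re - (lam j).re) / N := by
    rw [div_natCast_re, sub_re]
  have hk₀ : (0 : ℝ) ≤ k := by
    rw [← intCast_re, ← hk, hre]
    exact div_nonneg (sub_nonneg.2 (hc.2 i j h hij)) N.cast_nonneg
  obtain ⟨n, rfl⟩ := Int.eq_ofNat_of_zero_le (Int.cast_nonneg_iff.1 hk₀)
  rw [sub_div, sub_eq_iff_eq_add'] at hk
  exact ⟨n, hk⟩

theorem polesIn (hc : IsCongruenceGrouping lam c) (j : Fin N) :
    PolesIn (fun i => lam i / N) (blockPrefix c j) (lam j / N) := fun _ hi =>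
  hc.exists_natCast (mem_blockPrefix.1 hi).1 (mem_blockPrefix.1 hi).2

theorem ne_neg_natCast (hc : IsCongruenceGrouping lam c) (hj : blockPos c j = 1) (hi : i ≠ j)
    (m : ℕ) : 1 - lam i / N + lam j / N ≠ -(m : ℂ) := by
  intro hm
  have hidx : c.index i = c.index j := (hc.1 i j).2 ⟨m + 1, by
    rw [sub_div]
    push_cast
    linear_combination -hm⟩
  have hji : j ≤ i := by
    by_contra! hlt
    have hmem : i ∈ blockPrefix c j := mem_blockPrefix.2 ⟨hidx, hlt.le⟩
    rw [blockPrefix_eq_singleton hj, Finset.mem_singleton] at hmem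
    exact hi hmem
  obtain ⟨n, hn⟩ := hc.exists_natCast hidx.symm hji
  have hsucc : ((n + m + 1 : ℕ) : ℂ) = 0 := by
    push_cast
    linear_combination hm - hn
  exact Nat.succ_ne_zero _ (Nat.cast_eq_zero.1 hsucc)

theorem exp_eq_exp_iff (hc : IsCongruenceGrouping lam c) :
    exp (lam i / N * (2 * Real.pi * I)) = exp (lam j / N * (2 * Real.pi * I)) ↔
      c.index i = c.index j := by
  rw [hc.1, Complex.exp_eq_exp_iff_exists_int]
  refine exists_congr fun k => ?_
  rw [← add_mul, mul_left_inj' two_pi_I_ne_zero, sub_div, sub_eq_iff_eq_add']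

theorem differentiable_blockG (hc : IsCongruenceGrouping lam c) (j : Fin N) :
    Differentiable ℂ (blockG lam c j) :=
  (hc.polesIn j).differentiable_frontG

theorem diffProd_blockG (hc : IsCongruenceGrouping lam c) (j : Fin N) (w : ℂ) :
    diffProd 1 (fun i => lam i / N) (blockG lam c j) w =
      (-1) ^ blockPos c j * exp w * blockG lam c j w :=
  (hc.polesIn j).diffProd_frontG w

theorem monodromy_blockG (hc : IsCongruenceGrouping lam c) (hj : j ∉ blockPrefix c i)
    (hij : blockPrefix c j = insert j (blockPrefix c i)) :
    (shift (2 * Real.pi * I) - algebraMap ℂ _ (exp (lam j / N * (2 * Real.pi * I))))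
        (blockG lam c j) =
      (-(2 * Real.pi * I) * exp (Real.pi * I * (lam j / N))) •
        shift (Real.pi * I) (blockG lam c i) := by
  have h := PolesIn.monodromy_frontG hj (hij ▸ hc.polesIn j)
  rwa [← hij] at h

theorem pow_monodromy_blockG (hc : IsCongruenceGrouping lam c) {m : ℕ}
    (hj : blockPos c j = m + 1) :
    ((shift (2 * Real.pi * I) - algebraMap ℂ _ (exp (lam j / N * (2 * Real.pi * I)))) ^ (m + 1))
        (blockG lam c j) = 0 ∧
      ((shift (2 * Real.pi * I) - algebraMap ℂ _ (exp (lam j / N * (2 * Real.pi * I)))) ^ m)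
        (blockG lam c j) ≠ 0 := by
  induction m generalizing j with
  | zero =>
    have hG : blockG lam c j = frontG (fun i => lam i / N) {j} := by
      rw [← blockPrefix_eq_singleton hj]
      rfl
    have hmono := (polesIn_singleton (fun i => lam i / N) j).monodromy_frontG
      (Finset.notMem_empty j)
    rw [frontG_empty, map_zero, smul_zero] at hmono
    rw [hG, zero_add, pow_one, pow_zero]
    exact ⟨hmono, frontG_singleton_ne_zero fun i hi => hc.ne_neg_natCast hj hi⟩
  | succ m ih =>
    obtain ⟨i, hidx, hnotMem, hinsert⟩ :=
      exists_blockPrefix_eq_insert (hj ▸ Nat.lt_add_left_iff_pos.2 m.succ_pos)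
    have hpos : blockPos c i = m + 1 := by
      rw [blockPos, hinsert, Finset.card_insert_of_notMem hnotMem] at hj
      exact Nat.succ.inj hj
    obtain ⟨hzero, hne⟩ := ih hpos
    rw [hc.exp_eq_exp_iff.2 hidx] at hzero hne
    have hconst : -(2 * Real.pi * I) * exp (Real.pi * I * (lam j / N)) ≠ 0 :=
      mul_ne_zero (neg_ne_zero.2 two_pi_I_ne_zero) (exp_ne_zero _)
    have hmono := hc.monodromy_blockG hnotMem hinsert
    set T := shift (2 * Real.pi * I) - algebraMap ℂ _ (exp (lam j / N * (2 * Real.pi * I)))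
    have hstep : ∀ k : ℕ, (T ^ (k + 1)) (blockG lam c j) =
        (-(2 * Real.pi * I) * exp (Real.pi * I * (lam j / N))) •
          shift (Real.pi * I) ((T ^ k) (blockG lam c i)) := fun k => by
      rw [pow_succ, Module.End.mul_apply, hmono, map_smul, pow_shift_sub_apply_shift]
    rw [hstep, hstep, hzero, map_zero, smul_zero]
    exact ⟨rfl, smul_ne_zero hconst ((map_ne_zero_iff _ (shift_injective _)).2 hne)⟩

theorem linearIndependent_shift (hc : IsCongruenceGrouping lam c) (κ : Fin N → ℂ) :
    LinearIndependent ℂ fun j => shift (κ j) (blockG lam c j) := by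
  have hpos : ∀ j, blockPos c j = blockPos c j - 1 + 1 := fun j =>
    (Nat.sub_add_cancel (blockPos_pos c j)).symm
  refine linearIndependent_of_genEigenvectors (shift (2 * Real.pi * I))
    (α := fun j => exp (lam j / N * (2 * Real.pi * I))) (r := fun j => blockPos c j - 1) ?_ ?_ ?_
  · intro i j hα hr
    refine eq_of_blockPos_eq (hc.exp_eq_exp_iff.1 hα) ?_
    rw [hpos i, hpos j, hr]
  · intro j
    rw [pow_shift_sub_apply_shift, (hc.pow_monodromy_blockG (hpos j)).1, map_zero]
  · intro j
    rw [pow_shift_sub_apply_shift]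
    exact (map_ne_zero_iff _ (shift_injective _)).2 (hc.pow_monodromy_blockG (hpos j)).2

end IsCongruenceGrouping

end Blocks

section Substitution

open Complex

theorem mul_deriv_eq_of_exp_eq {U : Set ℂ} (hU : IsOpen U) {L : ℂ → ℂ}
    (hL : DifferentiableOn ℂ L U) {A : ℂ} {k : ℕ} (hexp : ∀ z ∈ U, exp (L z) = A * z ^ k) :
    ∀ z ∈ U, z * deriv L z = k := by
  intro z hz
  have hleft : HasDerivAt (fun z => exp (L z)) (exp (L z) * deriv L z) z :=
    (hL.differentiableAt (hU.mem_nhds hz)).hasDerivAt.cexp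
  have hright : HasDerivAt (fun z : ℂ => A * z ^ k) (A * (k * z ^ (k - 1))) z :=
    (hasDerivAt_pow k z).const_mul A
  have heq := hleft.unique
    (hright.congr_of_eventuallyEq (eventuallyEq_of_mem (hU.mem_nhds hz) hexp))
  refine mul_left_cancel₀ (exp_ne_zero (L z)) ?_
  rw [mul_left_comm, heq, hexp z hz]
  rcases k with _ | k
  · simp
  · rw [Nat.add_sub_cancel, pow_succ]
    ring

theorem eq_add_of_mul_deriv_eq {U : Set ℂ} (hU : IsPuncturedDomain U) {L L₀ : ℂ → ℂ} {k : ℂ}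
    (hL : DifferentiableOn ℂ L U) (hL₀ : DifferentiableOn ℂ L₀ U)
    (hLk : ∀ z ∈ U, z * deriv L z = k) (hL₀k : ∀ z ∈ U, z * deriv L₀ z = k) :
    ∃ κ, ∀ z ∈ U, L z = L₀ z + κ := by
  obtain ⟨hUo, hUc, h0⟩ := hU
  refine hUo.exists_eq_add_of_deriv_eq hUc.isPreconnected hL hL₀ fun z hz => ?_
  exact mul_left_cancel₀ (ne_of_mem_of_not_mem hz h0) ((hLk z hz).trans (hL₀k z hz).symm)

theorem eq_zero_of_eqOn_comp_zero {U : Set ℂ} (hU : IsOpen U) {L H : ℂ → ℂ}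
    (hL : DifferentiableOn ℂ L U) {z₀ : ℂ} (hz₀ : z₀ ∈ U) (hderiv : deriv L z₀ ≠ 0)
    (hH : Differentiable ℂ H) (hzero : ∀ z ∈ U, H (L z) = 0) : H = 0 := by
  have hstrict : HasStrictDerivAt L (deriv L z₀) z₀ :=
    (hL.analyticAt (hU.mem_nhds hz₀)).hasStrictDerivAt
  have hev : H =ᶠ[𝓝 (L z₀)] 0 := by
    rw [← hstrict.map_nhds_eq hderiv]
    exact eventually_map.2 (eventually_of_mem (hU.mem_nhds hz₀) hzero)
  exact AnalyticOnNhd.eq_of_eventuallyEq (fun z _ => hH.analyticAt z)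
    (fun _ _ => analyticAt_const) hev

variable {N : ℕ} {lam : Fin N → ℂ} {c : Composition N} {U : Set ℂ} {k : ℂ} {L : Fin N → ℂ → ℂ}

theorem IsCongruenceGrouping.linearIndependent_blockG_comp (hc : IsCongruenceGrouping lam c)
    (hU : IsPuncturedDomain U) (hk : k ≠ 0) (hL : ∀ j, DifferentiableOn ℂ (L j) U)
    (hLk : ∀ j, ∀ z ∈ U, z * deriv (L j) z = k) :
    LinearIndependent ℂ fun j (z : U) => blockG lam c j (L j z) := by
  refine Fintype.linearIndependent_iff.2 fun a ha j₀ => ?_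
  obtain ⟨z₀, hz₀⟩ := hU.2.1.nonempty
  choose κ hκ using fun j => eq_add_of_mul_deriv_eq hU (hL j) (hL j₀) (hLk j) (hLk j₀)
  have hderiv : deriv (L j₀) z₀ ≠ 0 := right_ne_zero_of_mul ((hLk j₀ z₀ hz₀).trans_ne hk)
  refine Fintype.linearIndependent_iff.1 (hc.linearIndependent_shift κ) a ?_ j₀
  refine eq_zero_of_eqOn_comp_zero hU.1 (hL j₀) hz₀ hderiv ?_ fun z hz => ?_
  · exact Differentiable.sum fun j _ => Differentiable.const_smul
      ((hc.differentiable_blockG j).comp (differentiable_id.add_const (κ j))) (a j)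
  · have hz' := congrFun ha ⟨z, hz⟩
    simpa only [Finset.sum_apply, Pi.smul_apply, shift_apply, ← hκ _ z hz,
      Pi.zero_apply] using hz'

/-- Both equations are of this form in the variable `L j z`: `exp (L j z)` is
`(-1) ^ blockPos c j * ζ`, with `ζ = z` or `ζ = μ * (z / N) ^ N`. -/
theorem IsCongruenceGrouping.isFundamentalSystem (hN : 0 < N) (hc : IsCongruenceGrouping lam c)
    (hU : IsPuncturedDomain U) {A : ℂ} {k : ℕ} (hk : k ≠ 0)
    (hL : ∀ j, IsLogBranch U (fun z => (-1) ^ blockPos c j * (A * z ^ k)) (L j)) :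
    IsFundamentalSystem U
      (fun f => DifferentiableOn ℂ f U ∧
        ∀ z ∈ U, eulerProd (fun i => k * (lam i / N)) f z = (k : ℂ) ^ N * (A * z ^ k) * f z)
      (fun j z => blockG lam c j (L j z)) := by
  have hLk : ∀ j, ∀ z ∈ U, z * deriv (L j) z = k := fun j =>
    mul_deriv_eq_of_exp_eq hU.1 (hL j).1 fun z hz => by rw [(hL j).2 z hz, mul_assoc]
  have hdiff : ∀ j, DifferentiableOn ℂ (fun z => blockG lam c j (L j z)) U := fun j =>
    (hc.differentiable_blockG j).comp_differentiableOn (hL j).1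
  have hsol : ∀ j, ∀ z ∈ U,
      eulerProd (fun i => k * (lam i / N)) (fun z => blockG lam c j (L j z)) z =
        (k : ℂ) ^ N * (A * z ^ k) * blockG lam c j (L j z) := fun j z hz => by
    have hcomp := diffProd_comp (p := id) hU.1 (hL j).1 (hLk j) (hc.differentiable_blockG j)
      (fun i => lam i / N) hz
    have hsign : (-1 : ℂ) ^ blockPos c j * (-1) ^ blockPos c j = 1 := by
      rw [← mul_pow, neg_one_mul, neg_neg, one_pow]
    refine hcomp.trans ?_
    simp only [hc.diffProd_blockG, (hL j).2 z hz]
    linear_combination (k : ℂ) ^ N * (A * z ^ k) * blockG lam c j (L j z) * hsign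
  have hli := hc.linearIndependent_blockG_comp hU (Nat.cast_ne_zero.2 hk) (fun j => (hL j).1) hLk
  exact ⟨fun j => ⟨hdiff j, hsol j⟩, hli, fun f hf =>
    exists_eq_sum_of_linearIndependent (p := id) (q := fun z => (k : ℂ) ^ N * (A * z ^ k)) hN hU.1
      hU.2.1 differentiableOn_id (fun z hz => ne_of_mem_of_not_mem hz hU.2.2) (by fun_prop) hdiff
      hsol hli hf.1 hf.2⟩

theorem IsFundamentalSystem.congr {Sol Sol' : (ℂ → ℂ) → Prop} {u : Fin N → ℂ → ℂ}
    (h : IsFundamentalSystem U Sol u) (hSol : ∀ f, Sol f ↔ Sol' f) :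
    IsFundamentalSystem U Sol' u :=
  ⟨fun j => (hSol _).1 (h.1 j), h.2.1, fun f hf => h.2.2 f ((hSol f).2 hf)⟩

theorem IsCongruenceGrouping.blockG_eq_genHypergeometric (hc : IsCongruenceGrouping lam c)
    {j : Fin N} (hj : blockPos c j = 1) {ζ w : ℂ} (hw : exp w = -ζ) :
    blockG lam c j w = exp (lam j / N * w) / (∏ i, Gamma (1 + (lam j - lam i) / N)) *
      genHypergeometric (![] : Fin 0 → ℂ)
        (fun i : {i : Fin N // i ≠ j} => 1 + (lam j - lam i) / N) ζ := by
  simp only [sub_div]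
  rw [blockG, blockPrefix_eq_singleton hj]
  exact frontG_singleton_eq_genHypergeometric (b := fun i => lam i / N)
    (fun i hi => hc.ne_neg_natCast hj hi) hw

theorem IsCongruenceGrouping.isFundamentalSystem_isMeijerSolution (hN : 0 < N)
    (hc : IsCongruenceGrouping lam c) (hU : IsPuncturedDomain U)
    (hL : ∀ j, IsLogBranch U (fun ζ => (-1) ^ blockPos c j * ζ) (L j)) :
    IsFundamentalSystem U (IsMeijerSolution (fun i => lam i / N) U)
      (fun j ζ => blockG lam c j (L j ζ)) := by
  refine (hc.isFundamentalSystem hN hU (A := 1) one_ne_zero (by simpa using hL)).congr fun f =>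
    and_congr_right fun _ => forall₂_congr fun z _ => ?_
  simp only [Nat.cast_one, one_pow, one_mul, pow_one, sub_eq_zero]

theorem IsCongruenceGrouping.isFundamentalSystem_isEulerSolution (hN : 0 < N)
    (hc : IsCongruenceGrouping lam c) (μ : ℂ) (hU : IsPuncturedDomain U)
    (hL : ∀ j, IsLogBranch U (fun z => (-1) ^ blockPos c j * (μ * (z / N) ^ N)) (L j)) :
    IsFundamentalSystem U (IsEulerSolution lam μ U) (fun j z => blockG lam c j (L j z)) := by
  have hN' : (N : ℂ) ≠ 0 := Nat.cast_ne_zero.2 hN.ne'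
  have hvar : ∀ z : ℂ, μ * (z / N) ^ N = μ / (N : ℂ) ^ N * z ^ N := fun z => by
    rw [div_pow, mul_div_left_comm, mul_comm]
  simp only [hvar] at hL
  refine (hc.isFundamentalSystem hN hU hN.ne' hL).congr fun f =>
    and_congr_right fun _ => forall₂_congr fun z hz => ?_
  have hz₀ : z ≠ 0 := ne_of_mem_of_not_mem hz hU.2.2
  simp only [mul_div_cancel₀ _ hN', eulerTau]
  rw [inv_mul_eq_iff_eq_mul₀ (pow_ne_zero N hz₀), ← mul_assoc,
    mul_div_cancel₀ _ (pow_ne_zero N hN'), mul_comm μ, mul_assoc]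

end Substitution

end EulerMeijer

theorem theorem4p3 {N : ℕ} (hN : 0 < N) (lam : Fin N → ℂ) (c : Composition N)
    (hc : EulerMeijer.IsCongruenceGrouping lam c) :
    -- the sums of residues that define the functions converge absolutely
    (∀ (j : Fin N) (w : ℂ),
      Summable fun ω : EulerMeijer.meijerPoles (fun i => lam i / N) (EulerMeijer.blockPrefix c j) =>
        ‖EulerMeijer.residue (EulerMeijer.meijerIntegrand (p := 0) ![] ∅ (fun i => lam i / N)
          (EulerMeijer.blockPrefix c j) w) ω‖) ∧
    -- the first function of each class, in terms of `_0F_{N-1}`; here `w = log (-ζ)`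
    (∀ j : Fin N, EulerMeijer.blockPos c j = 1 → ∀ ζ w : ℂ, Complex.exp w = -ζ →
      EulerMeijer.blockG lam c j w =
        Complex.exp (lam j / N * w) / (∏ i, Complex.Gamma (1 + (lam j - lam i) / N)) *
          EulerMeijer.genHypergeometric (![] : Fin 0 → ℂ)
            (fun i : {i : Fin N // i ≠ j} => 1 + (lam j - lam i) / N) ζ) ∧
    -- the fundamental system in the variable `ζ`; `L j` is a branch of `log ((-1)^ℓ ζ)`
    (∀ U : Set ℂ, EulerMeijer.IsPuncturedDomain U → ∀ L : Fin N → ℂ → ℂ,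
      (∀ j, EulerMeijer.IsLogBranch U (fun ζ => (-1) ^ EulerMeijer.blockPos c j * ζ) (L j)) →
      EulerMeijer.IsFundamentalSystem U
        (EulerMeijer.IsMeijerSolution (fun i => lam i / N) U)
        (fun j ζ => EulerMeijer.blockG lam c j (L j ζ))) ∧
    -- the fundamental system of the Euler eigenvalue equation, from `ζ = μ (z/N)^N`
    (∀ μ : ℂ, μ ≠ 0 → ∀ U : Set ℂ, EulerMeijer.IsPuncturedDomain U → ∀ L : Fin N → ℂ → ℂ,
      (∀ j, EulerMeijer.IsLogBranch U
        (fun z => (-1) ^ EulerMeijer.blockPos c j * (μ * (z / N) ^ N)) (L j)) →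
      EulerMeijer.IsFundamentalSystem U
        (EulerMeijer.IsEulerSolution lam μ U)
        (fun j z => EulerMeijer.blockG lam c j (L j z))) :=
  ⟨fun j w => (hc.polesIn j).summable_norm_residue w,
    fun _ hj _ _ hw => hc.blockG_eq_genHypergeometric hj hw,
    fun _ hU _ hL => hc.isFundamentalSystem_isMeijerSolution hN hU hL,
    fun μ _ _ hU _ hL => hc.isFundamentalSystem_isEulerSolution hN μ hU hL⟩
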